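/- Let $d\ge 0$ be an integer and let $F:\mathbb R\to\mathbb R$ be a $C^3$, even, nonnegative function such that $F(u)=0$ iff $u=\pm1$, $F'(u)=0$ iff $u\in\{0,1,-1\}$, $F''(0)<0$ and $F''(\pm1)>0$. Let $D=\mathbb R\times(0,1)^d$, with points written $(x,y)$. Let $m:\mathbb R\to\mathbb R$ be the unique solution of $m'=\sqrt{2F(m)}$ with $m(0)=0$ and $m(\pm\infty)=\pm1$, put $m_\xi(x,y)=m(x-\xi)$ for $\xi\in\mathbb R$, and let $M=\{m_\xi:\xi\in\mathbb R\}$. Define $$\mathcal F(h)=\int_D\Big(\tfrac12|\nabla h|^2+F(h)\Big)\,dz-C_*,\qquad C_*=\int_{-1}^1\sqrt{2F(u)}\,du,$$ with values in $(-\infty,\infty]$, and $\mathrm{dist}_{L^2(D)}(h,M)=\inf_{\xi\in\mathbb R}\|h-m_\xi\|_{L^2(D)}\in[0,\infty]$. (i) There are constants $c_3,\delta_3>0$, depending only on $d$ and $F$, such that for every $h=m_\xi+v$ with $\xi\in\mathbb R$, $v\in H^1(D)$, $\langle v,\partial_xm_\xi\rangle_{L^2(D)}=0$, $\|v\|_{L^2(D)}\le\delta_3$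 and $\|v\|_{L^\infty(D)}\le1$, one has $$\mathcal F(h)\le c_3\|v\|_{H^1(D)}^2 ,\qquad \|v\|_{H^1(D)}^2=\|v\|_{L^2(D)}^2+\|\nabla v\|_{L^2(D)}^2 .$$ (ii) There are constants $c_0,\delta_0>0$, depending only on $d$ and $F$, such that for all $0\le\delta\le\delta_0$ and every piecewise differentiable $h:D\to\mathbb R$ which satisfies the boundary condition $h(\pm\infty,y)=\pm1$ for almost every $y\in(0,1)^d$ and $\mathrm{dist}_{L^2(D)}(h,M)>\delta$, one has $$\mathcal F(h)>c_0\delta^2 .$$ Here $h$ is called piecewise differentiable if it is continuous on $D$ and differentiable at every point of $D\setminus S$ for some relatively closed set $S\subset D$ whose $d$-dimensional Hausdorff measure is finite on every compact subset of $D$. -/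

import Mathlib

open MeasureTheory Set Filter Topology
open scoped ENNReal

namespace AllenCahn

noncomputable section

/-- A symmetric double-well potential with wells of equal depth at `±1`. -/
structure IsDoubleWell (F : ℝ → ℝ) : Prop where
  contDiff : ContDiff ℝ 3 F
  even : ∀ u, F (-u) = F u
  nonneg : ∀ u, 0 ≤ F u
  eq_zero_iff : ∀ u, F u = 0 ↔ u = 1 ∨ u = -1
  deriv_eq_zero_iff : ∀ u, deriv F u = 0 ↔ u = 0 ∨ u = 1 ∨ u = -1
  deriv2_zero : iteratedDeriv 2 F 0 < 0
  deriv2_one : 0 < iteratedDeriv 2 F 1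
  deriv2_neg_one : 0 < iteratedDeriv 2 F (-1)

/-- `m' = √(2 F(m))` on `ℝ`, `m(0) = 0`, `m(±∞) = ±1`. -/
structure IsProfile (F m : ℝ → ℝ) : Prop where
  hasDerivAt : ∀ x, HasDerivAt m (Real.sqrt (2 * F (m x))) x
  zero : m 0 = 0
  tendsto_atTop : Tendsto m atTop (𝓝 1)
  tendsto_atBot : Tendsto m atBot (𝓝 (-1))

/-- The transition profile: the solution `m` of `IsProfile F m` (it exists and is unique for a
double-well potential). -/
def profile (F : ℝ → ℝ) : ℝ → ℝ := Classical.epsilon (IsProfile F)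

/-- `ℝ^{d+1}`, with points `z = (x, y)`, `x = z 0` and `y i = z i.succ`. -/
abbrev Space (d : ℕ) : Type := EuclideanSpace ℝ (Fin (d + 1))

/-- The point `(x, y)` of `ℝ × ℝ^d = ℝ^{d+1}`. -/
def point {d : ℕ} (x : ℝ) (y : Fin d → ℝ) : Space d :=
  WithLp.toLp 2 (Fin.cons x y : Fin (d + 1) → ℝ)

/-- The cube `(0,1)^d`. -/
def cube (d : ℕ) : Set (Fin d → ℝ) := Set.pi Set.univ fun _ => Ioo (0 : ℝ) 1

/-- The domain `D = ℝ × (0,1)^d`. -/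
def domain (d : ℕ) : Set (Space d) := {z | ∀ i : Fin d, z i.succ ∈ Ioo (0 : ℝ) 1}

/-- Lebesgue measure on `D`. -/
def domainMeasure (d : ℕ) : Measure (Space d) := volume.restrict (domain d)

/-- The function `m_ξ(x, y) = m(x - ξ)`; the set `M` of minimizers is `{m_ξ : ξ ∈ ℝ}`. -/
def wave (F : ℝ → ℝ) (d : ℕ) (ξ : ℝ) (z : Space d) : ℝ := profile F (z 0 - ξ)

/-- `C_* = ∫_{-1}^{1} √(2 F(u)) du`. -/
def surfaceTension (F : ℝ → ℝ) : ℝ := ∫ u in (-1 : ℝ)..1, Real.sqrt (2 * F u)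

/-- The free energy `∫_D (½ |∇h|² + F(h)) dz - C_*` of `h`, with values in `(-∞, ∞]`. The gradient
`Dh` of `h` is a separate argument: it is the weak gradient for Sobolev functions and the pointwise
gradient for piecewise differentiable functions. -/
def freeEnergy (F : ℝ → ℝ) {d : ℕ} (h : Space d → ℝ) (Dh : Space d → Space d) : EReal :=
  ((∫⁻ z, ENNReal.ofReal (‖Dh z‖ ^ 2 / 2 + F (h z)) ∂(domainMeasure d) : ℝ≥0∞) : EReal)
    - ((surfaceTension F : ℝ) : EReal)

/-- `g` is the weak gradient of `u` on `D`. -/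
structure IsWeakGradient {d : ℕ} (u : Space d → ℝ) (g : Space d → Space d) : Prop where
  locallyIntegrableOn : LocallyIntegrableOn u (domain d)
  locallyIntegrableOn_grad : LocallyIntegrableOn g (domain d)
  integral_eq : ∀ φ : Space d → ℝ, ContDiff ℝ (⊤ : ℕ∞) φ → HasCompactSupport φ → tsupport φ ⊆ domain d →
    ∫ z, u z • gradient φ z ∂(domainMeasure d) = -∫ z, φ z • g z ∂(domainMeasure d)

/-- `u ∈ H¹(D)`, with weak gradient `g`. -/
structure IsH1 {d : ℕ} (u : Space d → ℝ) (g : Space d → Space d) : Prop where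
  memLp : MemLp u 2 (domainMeasure d)
  memLp_grad : MemLp g 2 (domainMeasure d)
  isWeakGradient : IsWeakGradient u g

/-- `‖u‖²_{H¹(D)} = ∫_D (u² + |∇u|²) dz` for `u ∈ H¹(D)` with weak gradient `g`. -/
def h1NormSq {d : ℕ} (u : Space d → ℝ) (g : Space d → Space d) : ℝ :=
  ∫ z, (u z ^ 2 + ‖g z‖ ^ 2) ∂(domainMeasure d)

/-- `(ξ, v)` are tubular coordinates of `h`: `h = m_ξ + v` on `D` and `⟨v, ∂ₓ m_ξ⟩_{L²(D)} = 0`. -/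
structure IsTubularCoord (F : ℝ → ℝ) {d : ℕ} (h : Space d → ℝ) (ξ : ℝ) (v : Space d → ℝ) :
    Prop where
  eq_add : h =ᵐ[domainMeasure d] fun z => wave F d ξ z + v z
  orthogonal : ∫ z, v z * deriv (profile F) (z 0 - ξ) ∂(domainMeasure d) = 0

/-- `dist_{L²(D)}(h, M) = inf_ξ ‖h - m_ξ‖_{L²(D)}`, in `[0, ∞]`. -/
def distL2 (F : ℝ → ℝ) {d : ℕ} (h : Space d → ℝ) : ℝ≥0∞ :=
  ⨅ ξ : ℝ, eLpNorm (fun z => h z - wave F d ξ z) 2 (domainMeasure d)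

/-- The boundary condition `h(±∞, y) = ±1`, for almost every `y ∈ (0,1)^d`. -/
def HasBoundaryValues {d : ℕ} (h : Space d → ℝ) : Prop :=
  ∀ᵐ y ∂((volume : Measure (Fin d → ℝ)).restrict (cube d)),
    Tendsto (fun x : ℝ => h (point x y)) atTop (𝓝 1) ∧
      Tendsto (fun x : ℝ => h (point x y)) atBot (𝓝 (-1))

/-- `h` is piecewise differentiable on `D`: it is continuous on `D`, and differentiable on the open
pieces into which a relatively closed set `S ⊆ D` of locally finite `d`-dimensional Hausdorff
measure (codimension one: for instance a locally finite union of pieces of hypersurfaces, or a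
discrete set if `d = 0`) divides `D`. -/
def PiecewiseDifferentiable {d : ℕ} (h : Space d → ℝ) : Prop :=
  ContinuousOn h (domain d) ∧
    ∃ S : Set (Space d), S ⊆ domain d ∧ IsOpen (domain d \ S) ∧
      (∀ K : Set (Space d), IsCompact K → K ⊆ domain d →
        Measure.hausdorffMeasure (d : ℝ) (S ∩ K) < ∞) ∧
      ∀ z ∈ domain d \ S, DifferentiableAt ℝ h z

end

end AllenCahn

/-!
Let `W` be the signed root of the potential: `W = √(2F)` between the wells and `W = -√(2F)`
outside them. It is a `C¹` function with `W W' = F'` (`IsDoubleWell.hasDerivAt_signedRoot`),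
positive between the wells, negative outside, and decreasing on the positive half-line. The profile
solves `m' = W(m)`.

The lower bound is first proved on the line. For a transition `f` from `-1` to `1` the integral of
`f' W(f)` is the constant `C_*`, so that completing the square turns the excess energy into
`½ ∫ (f' - W(f))²` (`IsTransition.integral_residual_sq`). Translate `f` so that `f(0) = 0`. Moving
against the flow of `u' = W(u)` costs energy, hence a small excess confines `f` on the right
half-line to a region in which `W` contracts towards the profile from time `1` on; a differential
inequality for `(f - m)²` bounds `∫ (f - m)²` by a multiple of the excess, and the left half-line
follows by reflection (`IsTransition.exists_lintegral_sub_sq_le`).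

In the cylinder, almost every line parallel to a coordinate axis meets the exceptional set of a
piecewise differentiable function in a countable set, by Eilenberg's inequality
(`ae_countable_slice`), so that the function is absolutely continuous on it as soon as its
derivative is integrable. The energy is the mean of the energies of the slices `x ↦ h(x, y)` plus half
the square integral of the derivatives in `y`, and the latter controls the mean square distance between
slices by a Poincaré inequality on the cube. A slice chosen by averaging is close to a translated
profile by the result on the line, and close to `h` on average (`exists_distL2_le`).

The upper bound is Taylor's formula for `F` at the profile: the zeroth order term is `C_*`, the
quadratic one is bounded by the `H¹` norm, and the first order one vanishes since `m'' = F'(m)`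
(`integral_first_variation`). As `v` only has a weak gradient, the last point is an integration by
parts against the function `m'(x - ξ)`, which is reduced by cutoffs and mollification to the
test functions in the definition of the weak gradient.
-/

namespace AllenCahn

/-! ### The signed root of the potential -/

/-- A continuous function whose derivative, defined near but not at `x`, extends continuously
to `x` is differentiable at `x`. -/
theorem hasDerivAt_of_eventually_hasDerivAt_of_ne {f g : ℝ → ℝ} {x : ℝ}
    (hd : ∀ᶠ y in 𝓝[≠] x, HasDerivAt f (g y) y) (hf : ContinuousAt f x)
    (hg : ContinuousAt g x) : HasDerivAt f (g x) x := by
  rw [← Iio_union_Ioi, nhdsWithin_union, eventually_sup] at hd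
  obtain ⟨hl, hr⟩ := hd
  have A : HasDerivWithinAt f (g x) (Ici x) x := by
    apply hasDerivWithinAt_Ici_of_tendsto_deriv (s := {y | HasDerivAt f (g y) y})
      (fun y hy => hy.differentiableAt.differentiableWithinAt) hf.continuousWithinAt hr
    refine (hg.tendsto.mono_left nhdsWithin_le_nhds).congr' ?_
    filter_upwards [hr] with y hy using hy.deriv.symm
  have B : HasDerivWithinAt f (g x) (Iic x) x := by
    apply hasDerivWithinAt_Iic_of_tendsto_deriv (s := {y | HasDerivAt f (g y) y})
      (fun y hy => hy.differentiableAt.differentiableWithinAt) hf.continuousWithinAt hl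
    refine (hg.tendsto.mono_left nhdsWithin_le_nhds).congr' ?_
    filter_upwards [hl] with y hy using hy.deriv.symm
  simpa using B.union A

/-- The root of `2 F` which is positive between the wells and negative outside them. -/
noncomputable def signedRoot (F : ℝ → ℝ) (u : ℝ) : ℝ :=
  if |u| ≤ 1 then √(2 * F u) else -√(2 * F u)

/-- The square of the derivative of `signedRoot F`, that is `F'² / (2 F)` extended by its limit
`F''` to the wells. -/
noncomputable def rootSlopeSq (F : ℝ → ℝ) (u : ℝ) : ℝ :=
  if F u = 0 then deriv (deriv F) u else deriv F u ^ 2 / (2 * F u)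

/-- The derivative of `signedRoot F`. -/
noncomputable def rootSlope (F : ℝ → ℝ) (u : ℝ) : ℝ :=
  if 0 ≤ u then -√(rootSlopeSq F u) else √(rootSlopeSq F u)

theorem signedRoot_eq_sqrt {F : ℝ → ℝ} {u : ℝ} (h : |u| ≤ 1) : signedRoot F u = √(2 * F u) := by
  simp [signedRoot, h]

namespace IsDoubleWell

variable {F : ℝ → ℝ}

theorem continuous (hF : IsDoubleWell F) : Continuous F := hF.contDiff.continuous

theorem hasDerivAt (hF : IsDoubleWell F) (u : ℝ) : HasDerivAt F (deriv F u) u :=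
  (hF.contDiff.differentiable (by norm_num) u).hasDerivAt

theorem contDiff_deriv (hF : IsDoubleWell F) : ContDiff ℝ 2 (deriv F) := by
  have := hF.contDiff
  rw [show (3 : WithTop ℕ∞) = 2 + 1 by norm_num, contDiff_succ_iff_deriv] at this
  exact this.2.2

theorem continuous_deriv (hF : IsDoubleWell F) : Continuous (deriv F) :=
  hF.contDiff_deriv.continuous

theorem hasDerivAt_deriv (hF : IsDoubleWell F) (u : ℝ) :
    HasDerivAt (deriv F) (deriv (deriv F) u) u :=
  (hF.contDiff_deriv.differentiable (by norm_num) u).hasDerivAt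

theorem continuous_deriv_deriv (hF : IsDoubleWell F) : Continuous (deriv (deriv F)) :=
  hF.contDiff_deriv.continuous_deriv (by norm_num)

theorem deriv_neg_arg (hF : IsDoubleWell F) (u : ℝ) : deriv F (-u) = -deriv F u := by
  have h : F = fun u => F (-u) := by ext u; exact (hF.even u).symm
  conv_rhs => rw [h, deriv_comp_neg]
  simp

theorem apply_one (hF : IsDoubleWell F) : F 1 = 0 := (hF.eq_zero_iff 1).2 (Or.inl rfl)

theorem pos_of_ne (hF : IsDoubleWell F) {u : ℝ} (h₁ : u ≠ 1) (h₂ : u ≠ -1) : 0 < F u :=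
  lt_of_le_of_ne (hF.nonneg u) fun h => by
    rcases (hF.eq_zero_iff u).1 h.symm with h | h <;> contradiction

theorem deriv_deriv_pos (hF : IsDoubleWell F) {u : ℝ} (hu : F u = 0) :
    0 < deriv (deriv F) u := by
  have h₁ := hF.deriv2_one
  have h₂ := hF.deriv2_neg_one
  rw [iteratedDeriv_succ, iteratedDeriv_one] at h₁ h₂
  rcases (hF.eq_zero_iff u).1 hu with rfl | rfl <;> assumption

theorem deriv_neg_of_mem (hF : IsDoubleWell F) {u : ℝ} (h₀ : 0 < u) (h₁ : u < 1) :
    deriv F u < 0 := by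
  rcases hasDerivWithinAt_forall_lt_or_forall_gt_of_forall_ne (convex_Ioo (0 : ℝ) 1)
    (fun x _ => (hF.hasDerivAt x).hasDerivWithinAt) (m := 0) (fun x hx h => by
      rcases (hF.deriv_eq_zero_iff x).1 h with h | h | h <;>
        · subst h; norm_num at hx) with h | h
  · exact h u ⟨h₀, h₁⟩
  · obtain ⟨c, hc, hs⟩ := exists_deriv_eq_slope F (zero_lt_one' ℝ) hF.continuous.continuousOn
      (fun x _ => (hF.hasDerivAt x).differentiableAt.differentiableWithinAt)
    have := h c hc
    have h0 := hF.pos_of_ne (u := 0) (by norm_num) (by norm_num)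
    rw [hs, hF.apply_one] at this
    norm_num at this
    linarith

theorem deriv_pos_of_one_lt (hF : IsDoubleWell F) {u : ℝ} (h₁ : 1 < u) : 0 < deriv F u := by
  rcases hasDerivWithinAt_forall_lt_or_forall_gt_of_forall_ne (convex_Ioi (1 : ℝ))
    (fun x _ => (hF.hasDerivAt x).hasDerivWithinAt) (m := 0) (fun x hx h => by
      rcases (hF.deriv_eq_zero_iff x).1 h with h | h | h <;>
        · subst h; norm_num at hx) with h | h
  · obtain ⟨c, hc, hs⟩ := exists_deriv_eq_slope F (one_lt_two (α := ℝ)) hF.continuous.continuousOn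
      (fun x _ => (hF.hasDerivAt x).differentiableAt.differentiableWithinAt)
    have := h c hc.1
    have h0 := hF.pos_of_ne (u := 2) (by norm_num) (by norm_num)
    rw [hs, hF.apply_one] at this
    norm_num at this
    linarith
  · exact h u h₁

theorem deriv_pos_of_mem (hF : IsDoubleWell F) {u : ℝ} (h₀ : u < 0) (h₁ : -1 < u) :
    0 < deriv F u := by
  have := hF.deriv_neg_of_mem (u := -u) (by linarith) (by linarith)
  rw [hF.deriv_neg_arg] at this
  linarith

theorem deriv_neg_of_lt (hF : IsDoubleWell F) {u : ℝ} (h₁ : u < -1) : deriv F u < 0 := by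
  have := hF.deriv_pos_of_one_lt (u := -u) (by linarith)
  rw [hF.deriv_neg_arg] at this
  linarith

theorem eventually_ne_zero (hF : IsDoubleWell F) (u : ℝ) : ∀ᶠ w in 𝓝[≠] u, F w ≠ 0 := by
  have hfin : ({1, -1} : Set ℝ).Finite := by simp
  have : ∀ᶠ w in 𝓝[≠] u, w ∉ ({1, -1} : Set ℝ) := by
    have h : (({1, -1} : Set ℝ) \ {u})ᶜ ∈ 𝓝 u :=
      (hfin.subset sdiff_subset).isClosed.isOpen_compl.mem_nhds (by simp)
    filter_upwards [nhdsWithin_le_nhds h, self_mem_nhdsWithin] with w hw hne hmem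
    exact hw ⟨hmem, hne⟩
  filter_upwards [this] with w hw h
  exact hw ((hF.eq_zero_iff w).1 h)

/-- Continuity at the wells is l'Hôpital's rule for `F'² / (2 F)`. -/
theorem continuous_rootSlopeSq (hF : IsDoubleWell F) : Continuous (rootSlopeSq F) := by
  refine continuous_iff_continuousAt.2 fun u => ?_
  by_cases hu : F u = 0
  · rw [continuousAt_iff_punctured_nhds]
    have hlim : Tendsto (fun w => deriv F w ^ 2 / (2 * F w)) (𝓝[≠] u)
        (𝓝 (deriv (deriv F) u)) := by
      have hd : deriv F u = 0 := by
        rw [hF.deriv_eq_zero_iff]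
        exact Or.inr ((hF.eq_zero_iff u).1 hu)
      have hne : ∀ᶠ w in 𝓝[≠] u, deriv F w ≠ 0 := by
        have := (hF.hasDerivAt_deriv u).eventually_ne (hF.deriv_deriv_pos hu).ne' (c := 0)
        exact this
      refine HasDerivAt.lhopital_zero_nhdsNE
        (f' := fun w => 2 * deriv F w * deriv (deriv F) w) (g' := fun w => 2 * deriv F w)
        (Eventually.of_forall fun w => ?_) (Eventually.of_forall fun w => ?_) ?_ ?_ ?_ ?_
      · simpa using (hF.hasDerivAt_deriv w).fun_pow 2
      · exact (hF.hasDerivAt w).const_mul 2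
      · filter_upwards [hne] with w hw using mul_ne_zero two_ne_zero hw
      · have := ((hF.continuous_deriv.tendsto u).pow 2).mono_left
          (nhdsWithin_le_nhds (s := {u}ᶜ))
        simpa [hd] using this
      · have := ((hF.continuous.tendsto u).const_mul 2).mono_left
          (nhdsWithin_le_nhds (s := {u}ᶜ))
        simpa [hu] using this
      · refine ((hF.continuous_deriv_deriv.tendsto u).mono_left nhdsWithin_le_nhds).congr' ?_
        filter_upwards [hne] with w hw
        field_simp
    have : rootSlopeSq F u = deriv (deriv F) u := by simp [rootSlopeSq, hu]
    rw [this]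
    refine hlim.congr' ?_
    filter_upwards [hF.eventually_ne_zero u] with w hw
    simp [rootSlopeSq, hw]
  · have : ContinuousAt (fun w => deriv F w ^ 2 / (2 * F w)) u :=
      (hF.continuous_deriv.pow 2).continuousAt.div
        (continuous_const.mul hF.continuous).continuousAt (by simpa using hu)
    refine this.congr ?_
    filter_upwards [hF.continuous.continuousAt.eventually_ne hu] with w hw
    simp [rootSlopeSq, hw]

theorem rootSlopeSq_zero (hF : IsDoubleWell F) : rootSlopeSq F 0 = 0 := by
  have h0 := hF.pos_of_ne (u := 0) (by norm_num) (by norm_num)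
  have : deriv F 0 = 0 := by simp [hF.deriv_eq_zero_iff]
  simp [rootSlopeSq, h0.ne', this]

theorem rootSlopeSq_pos (hF : IsDoubleWell F) {u : ℝ} (hu : u ≠ 0) : 0 < rootSlopeSq F u := by
  unfold rootSlopeSq
  split_ifs with h
  · exact hF.deriv_deriv_pos h
  · have hpos : 0 < F u := lt_of_le_of_ne (hF.nonneg u) (Ne.symm h)
    have : deriv F u ≠ 0 := fun hd => by
      rcases (hF.deriv_eq_zero_iff u).1 hd with h' | h'
      · exact hu h'
      · exact h ((hF.eq_zero_iff u).2 h')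
    positivity

theorem continuous_rootSlope (hF : IsDoubleWell F) : Continuous (rootSlope F) := by
  refine Continuous.if_le hF.continuous_rootSlopeSq.sqrt.neg hF.continuous_rootSlopeSq.sqrt
    continuous_const continuous_id fun x hx => ?_
  rw [← hx, hF.rootSlopeSq_zero]
  simp

theorem rootSlope_neg (hF : IsDoubleWell F) {u : ℝ} (hu : 0 < u) : rootSlope F u < 0 := by
  have := Real.sqrt_pos.2 (hF.rootSlopeSq_pos hu.ne')
  simp only [rootSlope, hu.le, if_true]
  linarith

theorem continuous_signedRoot (hF : IsDoubleWell F) : Continuous (signedRoot F) := by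
  have h := (continuous_const.mul hF.continuous : Continuous fun w => 2 * F w).sqrt
  refine Continuous.if_le h h.neg continuous_abs continuous_const fun x hx => ?_
  have : F x = 0 := (hF.eq_zero_iff x).2 ((abs_eq zero_le_one).1 hx)
  simp [this]

theorem signedRoot_sq (hF : IsDoubleWell F) (u : ℝ) : signedRoot F u ^ 2 = 2 * F u := by
  have := Real.sq_sqrt (mul_nonneg zero_le_two (hF.nonneg u))
  unfold signedRoot
  split_ifs
  · exact this
  · rw [neg_sq]; exact this

theorem signedRoot_neg_arg (hF : IsDoubleWell F) (u : ℝ) :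
    signedRoot F (-u) = signedRoot F u := by
  simp [signedRoot, hF.even]

theorem signedRoot_pos (hF : IsDoubleWell F) {u : ℝ} (h : |u| < 1) : 0 < signedRoot F u := by
  obtain ⟨h₁, h₂⟩ := abs_lt.1 h
  simp only [signedRoot, h.le, if_true]
  exact Real.sqrt_pos.2 (mul_pos two_pos (hF.pos_of_ne h₂.ne h₁.ne'))

theorem signedRoot_neg (hF : IsDoubleWell F) {u : ℝ} (h : 1 < u) : signedRoot F u < 0 := by
  have h' : ¬ |u| ≤ 1 := by rw [abs_of_pos (by linarith)]; linarith
  simp only [signedRoot, h', if_false, Left.neg_neg_iff]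
  exact Real.sqrt_pos.2 (mul_pos two_pos (hF.pos_of_ne h.ne' (by linarith)))

theorem sqrt_rootSlopeSq {u : ℝ} (hu : F u ≠ 0) :
    √(rootSlopeSq F u) = |deriv F u| / √(2 * F u) := by
  simp only [rootSlopeSq, hu, if_false]
  rw [Real.sqrt_div (sq_nonneg _), Real.sqrt_sq_eq_abs]

/-- The signed root is `C¹`. The formula for its derivative holds off the wells, and at the wells
the change of sign of the root matches that of `F'`. -/
theorem hasDerivAt_signedRoot (hF : IsDoubleWell F) (u : ℝ) :
    HasDerivAt (signedRoot F) (rootSlope F u) u := by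
  have key : ∀ w, F w ≠ 0 → HasDerivAt (signedRoot F) (rootSlope F w) w := by
    intro w hw
    have hpos : 0 < F w := lt_of_le_of_ne (hF.nonneg w) (Ne.symm hw)
    have hroot : HasDerivAt (fun w => √(2 * F w)) (deriv F w / √(2 * F w)) w := by
      have := ((hF.hasDerivAt w).const_mul 2).sqrt (by positivity)
      convert this using 1
      field_simp
    have hne : |w| ≠ 1 := fun h => hw ((hF.eq_zero_iff w).2 ((abs_eq zero_le_one).1 h))
    rcases lt_or_gt_of_ne hne with h | h
    · have hs : rootSlope F w = deriv F w / √(2 * F w) := by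
        obtain ⟨h₁, h₂⟩ := abs_lt.1 h
        unfold rootSlope
        rw [sqrt_rootSlopeSq hw]
        split_ifs with h0
        · rcases h0.eq_or_lt with rfl | h0
          · simp [(hF.deriv_eq_zero_iff 0).2 (Or.inl rfl)]
          · rw [abs_of_neg (hF.deriv_neg_of_mem h0 h₂)]; ring
        · rw [abs_of_pos (hF.deriv_pos_of_mem (not_le.1 h0) h₁)]
      rw [hs]
      refine hroot.congr_of_eventuallyEq ?_
      filter_upwards [continuous_abs.continuousAt.eventually_lt_const h] with z hz
      exact signedRoot_eq_sqrt hz.le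
    · have hs : rootSlope F w = -(deriv F w / √(2 * F w)) := by
        unfold rootSlope
        rw [sqrt_rootSlopeSq hw]
        split_ifs with h0
        · rw [abs_of_nonneg h0] at h
          rw [abs_of_pos (hF.deriv_pos_of_one_lt h)]
        · rw [abs_of_neg (not_le.1 h0)] at h
          rw [abs_of_neg (hF.deriv_neg_of_lt (by linarith))]; ring
      rw [hs]
      refine hroot.neg.congr_of_eventuallyEq ?_
      filter_upwards [continuous_abs.continuousAt.eventually_const_lt h] with z hz
      simp [signedRoot, not_le.2 hz]
  refine hasDerivAt_of_eventually_hasDerivAt_of_ne ?_ hF.continuous_signedRoot.continuousAt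
    hF.continuous_rootSlope.continuousAt
  filter_upwards [hF.eventually_ne_zero u] with w hw using key w hw

theorem rootSlope_mul_signedRoot (hF : IsDoubleWell F) (u : ℝ) :
    rootSlope F u * signedRoot F u = deriv F u := by
  have h₁ := (hF.hasDerivAt_signedRoot u).pow 2
  have h₂ := (hF.hasDerivAt u).const_mul 2
  have : signedRoot F ^ 2 = fun u => 2 * F u := by ext u; exact hF.signedRoot_sq u
  rw [this] at h₁
  have := h₁.unique h₂
  norm_num at this
  linarith

/-- The signed root is Lipschitz on bounded intervals. -/
theorem exists_abs_signedRoot_sub_le (hF : IsDoubleWell F) (R : ℝ) :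
    ∃ K, 0 < K ∧ ∀ u w, |u| ≤ R → |w| ≤ R → |signedRoot F u - signedRoot F w| ≤ K * |u - w| := by
  obtain ⟨K, hK⟩ := (isCompact_Icc (a := -R) (b := R)).exists_bound_of_continuousOn
    hF.continuous_rootSlope.continuousOn
  refine ⟨max K 1, by positivity, fun u w hu hw => ?_⟩
  exact (convex_Icc (-R) R).norm_image_sub_le_of_norm_hasDerivWithin_le
    (fun x _ => (hF.hasDerivAt_signedRoot x).hasDerivWithinAt)
    (fun x hx => (hK x hx).trans (le_max_left _ _)) (abs_le.1 hw) (abs_le.1 hu)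

/-- On a compact interval of positive numbers the signed root decreases at a positive rate. -/
theorem exists_signedRoot_sub_le (hF : IsDoubleWell F) {a b : ℝ} (ha : 0 < a) :
    ∃ κ, 0 < κ ∧ ∀ u w, a ≤ u → u ≤ w → w ≤ b →
      signedRoot F w - signedRoot F u ≤ -κ * (w - u) := by
  rcases lt_or_ge b a with hab | hab
  · exact ⟨1, one_pos, fun u w h₁ h₂ h₃ => by linarith⟩
  obtain ⟨c, hc, hmax⟩ := (isCompact_Icc (a := a) (b := b)).exists_isMaxOn
    (nonempty_Icc.2 hab) hF.continuous_rootSlope.continuousOn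
  refine ⟨-rootSlope F c, by linarith [hF.rootSlope_neg (ha.trans_le hc.1)], ?_⟩
  intro u w h₁ h₂ h₃
  rw [neg_neg]
  refine (convex_Icc a b).image_sub_le_mul_sub_of_deriv_le hF.continuous_signedRoot.continuousOn
    (fun x _ => (hF.hasDerivAt_signedRoot x).differentiableAt.differentiableWithinAt)
    (fun x hx => ?_) u ⟨h₁, h₂.trans h₃⟩ w ⟨h₁.trans h₂, h₃⟩ h₂
  rw [(hF.hasDerivAt_signedRoot x).deriv]
  exact hmax (interior_subset hx)

end IsDoubleWell

/-! ### The transition profile -/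

/-- The primitive of `signedRoot F` vanishing at `0`. Along any transition from `-1` to `1` it
increases by `surfaceTension F`. -/
noncomputable def rootPrimitive (F : ℝ → ℝ) (u : ℝ) : ℝ := ∫ s in (0 : ℝ)..u, signedRoot F s

/-- The derivative of a bounded nondecreasing `C¹` function is integrable. -/
theorem integrable_deriv_of_nonneg_of_bounded {g g' : ℝ → ℝ} (hg : ∀ x, HasDerivAt g (g' x) x)
    (hc : Continuous g') (hpos : ∀ x, 0 ≤ g' x) {C : ℝ} (hC : ∀ x, |g x| ≤ C) :
    Integrable g' := by
  refine integrable_of_intervalIntegral_norm_bounded (l := atTop) (a := fun R : ℝ => -R)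
    (b := fun R : ℝ => R) (2 * C) (fun R => ?_) tendsto_neg_atTop_atBot tendsto_id
    (Eventually.of_forall fun R => ?_)
  · exact (hc.integrableOn_Icc).mono_set Ioc_subset_Icc_self
  · have : ∫ x in (-R)..R, ‖g' x‖ = ∫ x in (-R)..R, g' x :=
      intervalIntegral.integral_congr fun x _ => by simp [abs_of_nonneg (hpos x)]
    rw [this, intervalIntegral.integral_eq_sub_of_hasDerivAt (fun x _ => hg x)
      (hc.intervalIntegrable _ _)]
    linarith [(abs_le.1 (hC R)).2, (abs_le.1 (hC (-R))).1]

namespace IsDoubleWell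

variable {F : ℝ → ℝ}

theorem hasDerivAt_rootPrimitive (hF : IsDoubleWell F) (u : ℝ) :
    HasDerivAt (rootPrimitive F) (signedRoot F u) u :=
  intervalIntegral.integral_hasDerivAt_right (hF.continuous_signedRoot.intervalIntegrable _ _)
    (hF.continuous_signedRoot.stronglyMeasurableAtFilter _ _)
    hF.continuous_signedRoot.continuousAt

theorem continuous_rootPrimitive (hF : IsDoubleWell F) : Continuous (rootPrimitive F) :=
  continuous_iff_continuousAt.2 fun u => (hF.hasDerivAt_rootPrimitive u).continuousAt

theorem rootPrimitive_one_sub (hF : IsDoubleWell F) :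
    rootPrimitive F 1 - rootPrimitive F (-1) = surfaceTension F := by
  rw [rootPrimitive, rootPrimitive, intervalIntegral.integral_interval_sub_left
    (hF.continuous_signedRoot.intervalIntegrable _ _)
    (hF.continuous_signedRoot.intervalIntegrable _ _), surfaceTension]
  refine intervalIntegral.integral_congr fun u hu => ?_
  rw [uIcc_of_le (by norm_num)] at hu
  exact signedRoot_eq_sqrt (abs_le.2 hu)

theorem rootPrimitive_neg_arg (hF : IsDoubleWell F) (u : ℝ) :
    rootPrimitive F (-u) = -rootPrimitive F u := by
  have h := intervalIntegral.integral_comp_neg (a := 0) (b := u) (signedRoot F)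
  simp only [hF.signedRoot_neg_arg, neg_zero] at h
  rw [rootPrimitive, rootPrimitive, h, intervalIntegral.integral_symm]

theorem strictMonoOn_rootPrimitive (hF : IsDoubleWell F) :
    StrictMonoOn (rootPrimitive F) (Icc (-1) 1) := by
  refine strictMonoOn_of_deriv_pos (convex_Icc _ _) hF.continuous_rootPrimitive.continuousOn
    fun x hx => ?_
  rw [interior_Icc] at hx
  rw [(hF.hasDerivAt_rootPrimitive x).deriv]
  exact hF.signedRoot_pos (abs_lt.2 hx)

theorem strictAntiOn_rootPrimitive (hF : IsDoubleWell F) :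
    StrictAntiOn (rootPrimitive F) (Ici 1) := by
  refine strictAntiOn_of_deriv_neg (convex_Ici _) hF.continuous_rootPrimitive.continuousOn
    fun x hx => ?_
  rw [interior_Ici] at hx
  rw [(hF.hasDerivAt_rootPrimitive x).deriv]
  exact hF.signedRoot_neg hx

/-- The time `∫₀ᵘ ds / √(2 F(s))` which the profile needs to reach the height `u` diverges at
the wells. -/
theorem exists_le_integral_inv_signedRoot (hF : IsDoubleWell F) (T : ℝ) :
    ∃ u ∈ Ico (0 : ℝ) 1, T ≤ ∫ s in (0 : ℝ)..u, (signedRoot F s)⁻¹ := by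
  obtain ⟨K, hK, hLip⟩ := hF.exists_abs_signedRoot_sub_le 1
  have hexp : Real.exp (-(K * |T|)) ≤ 1 := Real.exp_le_one_iff.2 (by
    have := mul_nonneg hK.le (abs_nonneg T); linarith)
  have hexp' := Real.exp_pos (-(K * |T|))
  refine ⟨1 - Real.exp (-(K * |T|)), ⟨by linarith, by linarith⟩, ?_⟩
  set u := 1 - Real.exp (-(K * |T|)) with hu
  have hcont : ContinuousOn (fun s => (signedRoot F s)⁻¹) (Icc 0 u) :=
    hF.continuous_signedRoot.continuousOn.inv₀ fun s hs =>
      (hF.signedRoot_pos (abs_lt.2 ⟨by linarith [hs.1], by linarith [hs.2]⟩)).ne'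
  have hcont' : ContinuousOn (fun s => K⁻¹ * (1 - s)⁻¹) (Icc 0 u) :=
    continuousOn_const.mul ((continuousOn_const.sub continuousOn_id).inv₀ fun s hs => by
      exact (by linarith [hs.2] : 1 - s ≠ 0))
  have hval : ∫ s in (0 : ℝ)..u, K⁻¹ * (1 - s)⁻¹ = |T| := by
    have hd : ∀ s ∈ uIcc 0 u,
        HasDerivAt (fun s => K⁻¹ * -Real.log (1 - s)) (K⁻¹ * (1 - s)⁻¹) s := by
      intro s hs
      rw [uIcc_of_le (by linarith)] at hs
      have hne : 1 - s ≠ 0 := by linarith [hs.2]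
      have := (((hasDerivAt_id s).const_sub 1).log hne).fun_neg.const_mul K⁻¹
      rw [neg_div, neg_neg, one_div] at this
      exact this
    rw [intervalIntegral.integral_eq_sub_of_hasDerivAt hd
      (by rw [← uIcc_of_le (show (0 : ℝ) ≤ u by linarith)] at hcont'
          exact hcont'.intervalIntegrable)]
    simp only [hu, sub_sub_cancel, Real.log_exp, sub_zero, Real.log_one]
    field_simp
    ring
  rw [← uIcc_of_le (show (0 : ℝ) ≤ u by linarith)] at hcont hcont'
  refine (le_abs_self T).trans (hval ▸ intervalIntegral.integral_mono_on (by linarith)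
    hcont'.intervalIntegrable hcont.intervalIntegrable fun s hs => ?_)
  have hpos : 0 < signedRoot F s :=
    hF.signedRoot_pos (abs_lt.2 ⟨by linarith [hs.1], by linarith [hs.2]⟩)
  have hs1 : 0 < 1 - s := by linarith [hs.2]
  rw [← mul_inv]
  refine inv_anti₀ hpos ?_
  have h := hLip s 1 (abs_le.2 ⟨by linarith [hs.1], by linarith [hs.2]⟩) (by simp)
  have h1 : signedRoot F 1 = 0 := by simp [signedRoot, hF.apply_one]
  rw [h1, sub_zero, abs_of_pos hpos, abs_sub_comm, abs_of_pos hs1] at h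
  exact h

/-- The profile is the inverse function of the time to reach a given height. -/
theorem exists_isProfile (hF : IsDoubleWell F) : ∃ m, IsProfile F m := by
  set G : ℝ → ℝ := fun u => ∫ s in (0 : ℝ)..u, (signedRoot F s)⁻¹ with hG
  have hpos : ∀ u ∈ Ioo (-1 : ℝ) 1, 0 < signedRoot F u := fun u hu =>
    hF.signedRoot_pos (abs_lt.2 hu)
  have hcont : ContinuousOn (fun s => (signedRoot F s)⁻¹) (Ioo (-1) 1) :=
    hF.continuous_signedRoot.continuousOn.inv₀ fun s hs => (hpos s hs).ne'
  have hderiv : ∀ u ∈ Ioo (-1 : ℝ) 1, HasDerivAt G (signedRoot F u)⁻¹ u := by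
    intro u hu
    refine intervalIntegral.integral_hasDerivAt_right ?_ ?_ ?_
    · exact (hcont.mono (ordConnected_Ioo.uIcc_subset (by norm_num) hu)).intervalIntegrable
    · exact hcont.stronglyMeasurableAtFilter isOpen_Ioo u hu
    · exact hcont.continuousAt (isOpen_Ioo.mem_nhds hu)
  have hGc : ContinuousOn G (Ioo (-1) 1) := fun u hu =>
    (hderiv u hu).continuousAt.continuousWithinAt
  have hmono : StrictMonoOn G (Ioo (-1) 1) := by
    refine strictMonoOn_of_deriv_pos (convex_Ioo _ _) hGc fun x hx => ?_
    rw [interior_Ioo] at hx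
    rw [(hderiv x hx).deriv]
    exact inv_pos.2 (hpos x hx)
  have hodd : ∀ u, G (-u) = -G u := by
    intro u
    have h := intervalIntegral.integral_comp_neg (a := 0) (b := u) fun s => (signedRoot F s)⁻¹
    simp only [hF.signedRoot_neg_arg, neg_zero] at h
    simp only [hG]
    rw [h, intervalIntegral.integral_symm]
  have hsurj : ∀ x, ∃ u ∈ Ioo (-1 : ℝ) 1, G u = x := by
    intro x
    obtain ⟨u, hu, hle⟩ := hF.exists_le_integral_inv_signedRoot |x|
    have hsub : Icc (-u) u ⊆ Ioo (-1) 1 := fun s hs =>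
      ⟨by linarith [hs.1, hu.2], by linarith [hs.2, hu.2]⟩
    have := intermediate_value_Icc (by linarith [hu.1] : -u ≤ u) (hGc.mono hsub)
    obtain ⟨s, hs, hx⟩ := this (show x ∈ Icc (G (-u)) (G u) from
      ⟨by rw [hodd]; linarith [neg_abs_le x], (le_abs_self x).trans hle⟩)
    exact ⟨s, hsub hs, hx⟩
  choose m hm hGm using hsurj
  have hmG : ∀ u ∈ Ioo (-1 : ℝ) 1, m (G u) = u := fun u hu =>
    hmono.injOn (hm _) hu (hGm _)
  have hm_mono : Monotone m := fun x y hxy =>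
    (hmono.le_iff_le (hm x) (hm y)).1 (by rwa [hGm, hGm])
  have hrange : range m = Ioo (-1) 1 :=
    Subset.antisymm (range_subset_iff.2 hm) fun u hu => ⟨G u, hmG u hu⟩
  have hm_cont : ∀ x, ContinuousAt m x := fun x =>
    continuousAt_of_monotoneOn_of_image_mem_nhds (hm_mono.monotoneOn univ) univ_mem
      (by rw [image_univ, hrange]; exact isOpen_Ioo.mem_nhds (hm x))
  refine ⟨m, fun x => ?_, ?_, ?_, ?_⟩
  · have := HasDerivAt.of_local_left_inverse (hm_cont x) (hderiv _ (hm x))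
      (inv_pos.2 (hpos _ (hm x))).ne' (Eventually.of_forall hGm)
    rwa [inv_inv, signedRoot_eq_sqrt (abs_le.2 ⟨(hm x).1.le, (hm x).2.le⟩)] at this
  · have : G 0 = 0 := by simp [hG]
    simpa [this] using hmG 0 (by norm_num)
  · exact tendsto_atTop_isLUB hm_mono (by rw [hrange]; exact isLUB_Ioo (by norm_num))
  · exact tendsto_atBot_isGLB hm_mono (by rw [hrange]; exact isGLB_Ioo (by norm_num))

theorem isProfile_profile (hF : IsDoubleWell F) : IsProfile F (profile F) :=
  Classical.epsilon_spec hF.exists_isProfile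

end IsDoubleWell

namespace IsProfile

variable {F m : ℝ → ℝ}

theorem continuous (hm : IsProfile F m) : Continuous m :=
  continuous_iff_continuousAt.2 fun x => (hm.hasDerivAt x).continuousAt

theorem monotone (hm : IsProfile F m) : Monotone m :=
  monotone_of_deriv_nonneg (fun x => (hm.hasDerivAt x).differentiableAt) fun x => by
    rw [(hm.hasDerivAt x).deriv]; exact Real.sqrt_nonneg _

theorem abs_le_one (hm : IsProfile F m) (x : ℝ) : |m x| ≤ 1 :=
  abs_le.2 ⟨hm.monotone.le_of_tendsto hm.tendsto_atBot x,
    hm.monotone.ge_of_tendsto hm.tendsto_atTop x⟩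

theorem hasDerivAt_signedRoot (hm : IsProfile F m) (x : ℝ) :
    HasDerivAt m (signedRoot F (m x)) x := by
  rw [signedRoot_eq_sqrt (hm.abs_le_one x)]
  exact hm.hasDerivAt x

theorem deriv_eq (hm : IsProfile F m) : deriv m = fun x => signedRoot F (m x) :=
  funext fun x => (hm.hasDerivAt_signedRoot x).deriv

/-- The profile is not stationary at `0`, where the signed root is positive. -/
theorem pos (hF : IsDoubleWell F) (hm : IsProfile F m) {x : ℝ} (hx : 0 < x) : 0 < m x := by
  refine lt_of_le_of_ne (hm.zero ▸ hm.monotone hx.le) fun h => ?_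
  have hd : HasDerivWithinAt m 0 (Ici 0) 0 := by
    have : HasDerivWithinAt (fun _ : ℝ => (0 : ℝ)) 0 (Ici 0) 0 := hasDerivWithinAt_const _ _ _
    refine this.congr_of_eventuallyEq ?_ hm.zero
    have hn : Icc 0 x ∈ 𝓝[≥] (0 : ℝ) := Icc_mem_nhdsGE hx
    filter_upwards [hn] with y hy
    exact le_antisymm (h ▸ hm.monotone hy.2) (hm.zero ▸ hm.monotone hy.1)
  have h1 := hd.derivWithin (uniqueDiffOn_Ici 0 0 self_mem_Ici)
  have h2 := (hm.hasDerivAt_signedRoot 0).hasDerivWithinAt.derivWithin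
    (uniqueDiffOn_Ici 0 0 self_mem_Ici)
  rw [h1, hm.zero] at h2
  exact (hF.signedRoot_pos (u := 0) (by norm_num)).ne h2

theorem reflect (hF : IsDoubleWell F) (hm : IsProfile F m) : IsProfile F fun x => -m (-x) where
  hasDerivAt x := by
    have := ((hm.hasDerivAt (-x)).scomp x (hasDerivAt_neg x)).neg
    simp only [hF.even, neg_smul, one_smul, neg_neg] at this ⊢
    exact this
  zero := by simp [hm.zero]
  tendsto_atTop := by simpa using (hm.tendsto_atBot.comp tendsto_neg_atTop_atBot).neg
  tendsto_atBot := (hm.tendsto_atTop.comp tendsto_neg_atBot_atTop).neg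

/-- The profile solves the Euler–Lagrange equation `m'' = F'(m)`. -/
theorem hasDerivAt_deriv (hF : IsDoubleWell F) (hm : IsProfile F m) (x : ℝ) :
    HasDerivAt (deriv m) (deriv F (m x)) x := by
  rw [hm.deriv_eq, ← hF.rootSlope_mul_signedRoot]
  exact (hF.hasDerivAt_signedRoot (m x)).comp x (hm.hasDerivAt_signedRoot x)

theorem deriv_sq (hF : IsDoubleWell F) (hm : IsProfile F m) (x : ℝ) :
    deriv m x ^ 2 = 2 * F (m x) := by
  rw [hm.deriv_eq, hF.signedRoot_sq]

theorem continuous_deriv (hF : IsDoubleWell F) (hm : IsProfile F m) : Continuous (deriv m) :=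
  hm.deriv_eq ▸ hF.continuous_signedRoot.comp hm.continuous

theorem hasDerivAt_rootPrimitive (hF : IsDoubleWell F) (hm : IsProfile F m) (x : ℝ) :
    HasDerivAt (fun x => rootPrimitive F (m x)) (deriv m x ^ 2) x := by
  have := (hF.hasDerivAt_rootPrimitive (m x)).comp x (hm.hasDerivAt_signedRoot x)
  rw [hm.deriv_eq, sq]
  exact this

theorem integrable_deriv_sq (hF : IsDoubleWell F) (hm : IsProfile F m) :
    Integrable fun x => deriv m x ^ 2 := by
  obtain ⟨C, hC⟩ := (isCompact_Icc (a := -1) (b := (1 : ℝ))).exists_bound_of_continuousOn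
    hF.continuous_rootPrimitive.continuousOn
  exact integrable_deriv_of_nonneg_of_bounded (hm.hasDerivAt_rootPrimitive hF)
    ((hm.continuous_deriv hF).pow 2) (fun x => sq_nonneg _)
    (fun x => hC _ (abs_le.1 (hm.abs_le_one x)))

theorem integral_deriv_sq (hF : IsDoubleWell F) (hm : IsProfile F m) :
    ∫ x, deriv m x ^ 2 = surfaceTension F := by
  rw [← hF.rootPrimitive_one_sub]
  exact integral_of_hasDerivAt_of_tendsto (hm.hasDerivAt_rootPrimitive hF)
    (hm.integrable_deriv_sq hF)
    ((hF.continuous_rootPrimitive.tendsto _).comp hm.tendsto_atBot)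
    ((hF.continuous_rootPrimitive.tendsto _).comp hm.tendsto_atTop)

theorem memLp_deriv (hF : IsDoubleWell F) (hm : IsProfile F m) : MemLp (deriv m) 2 :=
  (memLp_two_iff_integrable_sq (hm.continuous_deriv hF).aestronglyMeasurable).2
    (hm.integrable_deriv_sq hF)

theorem memLp_deriv_comp (hF : IsDoubleWell F) (hm : IsProfile F m) :
    MemLp (fun x => deriv F (m x)) 2 := by
  obtain ⟨C, hC⟩ := (isCompact_Icc (a := -1) (b := (1 : ℝ))).exists_bound_of_continuousOn
    hF.continuous_rootSlope.continuousOn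
  refine (hm.memLp_deriv hF).of_le_mul (c := C)
    (hF.continuous_deriv.comp hm.continuous).aestronglyMeasurable
    (Eventually.of_forall fun x => ?_)
  rw [← hF.rootSlope_mul_signedRoot, norm_mul, hm.deriv_eq]
  exact mul_le_mul_of_nonneg_right (hC _ (abs_le.1 (hm.abs_le_one x))) (norm_nonneg _)

end IsProfile

/-! ### Stability of the profile on the line -/

/-- A function on the line with finite energy, going from `-1` at `-∞` to `1` at `∞`, continuous
and differentiable off a countable set. -/
structure IsTransition (F f : ℝ → ℝ) : Prop where
  continuous : Continuous f
  differentiableAt : ∃ s : Set ℝ, s.Countable ∧ ∀ x ∉ s, DifferentiableAt ℝ f x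
  tendsto_atTop : Tendsto f atTop (𝓝 1)
  tendsto_atBot : Tendsto f atBot (𝓝 (-1))
  integrable : Integrable fun x => deriv f x ^ 2 / 2 + F (f x)

/-- The energy of `f` on the line, in excess of the energy of the profile. -/
noncomputable def lineExcess (F f : ℝ → ℝ) : ℝ :=
  (∫ x, (deriv f x ^ 2 / 2 + F (f x))) - surfaceTension F

/-- The defect of `f` in the first order equation `f' = signedRoot F (f)` of the profile. -/
noncomputable def residual (F f : ℝ → ℝ) (x : ℝ) : ℝ := deriv f x - signedRoot F (f x)

/-- A function whose derivative off a countable set is bounded by `φ` grows by at most `∫ φ`. -/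
theorem sub_le_integral_of_hasDerivAt_off_countable {g g' φ : ℝ → ℝ} {a b : ℝ} (hab : a ≤ b)
    {s : Set ℝ} (hs : s.Countable) (hg : ContinuousOn g (Icc a b))
    (hd : ∀ x ∈ Ioo a b \ s, HasDerivAt g (g' x) x) (hi : IntervalIntegrable g' volume a b)
    (hφ : IntervalIntegrable φ volume a b) (hle : ∀ x ∈ Icc a b, g' x ≤ φ x) :
    g b - g a ≤ ∫ x in a..b, φ x := by
  rw [← integral_eq_of_hasDerivAt_off_countable_of_le g g' hab hs hg hd hi]
  exact intervalIntegral.integral_mono_on hab hi hφ hle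

theorem _root_.MeasureTheory.Integrable.intervalIntegral_le_integral {φ : ℝ → ℝ}
    (h : Integrable φ) (h0 : ∀ x, 0 ≤ φ x) {a b : ℝ} (hab : a ≤ b) :
    ∫ x in a..b, φ x ≤ ∫ x, φ x := by
  rw [intervalIntegral.integral_of_le hab]
  exact setIntegral_le_integral h (Eventually.of_forall h0)

namespace IsTransition

variable {F f m : ℝ → ℝ}

theorem translate (hf : IsTransition F f) (ξ : ℝ) : IsTransition F fun x => f (x + ξ) where
  continuous := hf.continuous.comp (continuous_id.add continuous_const)
  differentiableAt := by
    obtain ⟨s, hs, hd⟩ := hf.differentiableAt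
    refine ⟨(fun x => x + ξ) ⁻¹' s, hs.preimage (add_left_injective ξ), fun x hx => ?_⟩
    exact (hd (x + ξ) hx).comp x (differentiableAt_id.add_const ξ)
  tendsto_atTop := hf.tendsto_atTop.comp (tendsto_atTop_add_const_right _ _ tendsto_id)
  tendsto_atBot := hf.tendsto_atBot.comp (tendsto_atBot_add_const_right _ _ tendsto_id)
  integrable := by
    simp only [deriv_comp_add_const]
    exact hf.integrable.comp_add_right ξ

theorem lineExcess_translate (f : ℝ → ℝ) (ξ : ℝ) :
    lineExcess F (fun x => f (x + ξ)) = lineExcess F f := by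
  simp only [lineExcess, deriv_comp_add_const]
  rw [integral_add_right_eq_self (fun x => deriv f x ^ 2 / 2 + F (f x))]

theorem deriv_reflect (f : ℝ → ℝ) (x : ℝ) : deriv (fun x => -f (-x)) x = deriv f (-x) := by
  rw [deriv.fun_neg, deriv_comp_neg, neg_neg]

theorem reflect (hF : IsDoubleWell F) (hf : IsTransition F f) :
    IsTransition F fun x => -f (-x) where
  continuous := (hf.continuous.comp continuous_neg).neg
  differentiableAt := by
    obtain ⟨s, hs, hd⟩ := hf.differentiableAt
    refine ⟨(fun x => -x) ⁻¹' s, hs.preimage neg_injective, fun x hx => ?_⟩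
    exact ((hd (-x) hx).comp x differentiableAt_id.neg).neg
  tendsto_atTop := by simpa using (hf.tendsto_atBot.comp tendsto_neg_atTop_atBot).neg
  tendsto_atBot := (hf.tendsto_atTop.comp tendsto_neg_atBot_atTop).neg
  integrable := by
    simp only [deriv_reflect, hF.even]
    exact hf.integrable.comp_neg

theorem lineExcess_reflect (hF : IsDoubleWell F) (f : ℝ → ℝ) :
    lineExcess F (fun x => -f (-x)) = lineExcess F f := by
  simp only [lineExcess, deriv_reflect, hF.even]
  rw [integral_neg_eq_self (fun x => deriv f x ^ 2 / 2 + F (f x))]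

theorem residual_sq (hF : IsDoubleWell F) (f : ℝ → ℝ) (x : ℝ) :
    residual F f x ^ 2 =
      2 * (deriv f x ^ 2 / 2 + F (f x)) - 2 * (deriv f x * signedRoot F (f x)) := by
  have := hF.signedRoot_sq (f x)
  rw [residual]
  linear_combination this

theorem aestronglyMeasurable_flux (hF : IsDoubleWell F) (hf : IsTransition F f) :
    AEStronglyMeasurable (fun x => deriv f x * signedRoot F (f x)) :=
  ((measurable_deriv f).mul
    (hF.continuous_signedRoot.comp hf.continuous).measurable).aestronglyMeasurable

theorem integrable_flux (hF : IsDoubleWell F) (hf : IsTransition F f) :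
    Integrable fun x => deriv f x * signedRoot F (f x) := by
  refine hf.integrable.mono' (hf.aestronglyMeasurable_flux hF) (Eventually.of_forall fun x => ?_)
  have := hF.signedRoot_sq (f x)
  rw [Real.norm_eq_abs, abs_le]
  constructor <;>
    nlinarith [sq_nonneg (deriv f x - signedRoot F (f x)),
      sq_nonneg (deriv f x + signedRoot F (f x))]

theorem integral_flux_interval (hF : IsDoubleWell F) (hf : IsTransition F f) {a b : ℝ}
    (hab : a ≤ b) : ∫ x in a..b, deriv f x * signedRoot F (f x) =
      rootPrimitive F (f b) - rootPrimitive F (f a) := by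
  obtain ⟨s, hs, hd⟩ := hf.differentiableAt
  refine integral_eq_of_hasDerivAt_off_countable_of_le (fun x => rootPrimitive F (f x)) _ hab hs
    (hF.continuous_rootPrimitive.comp hf.continuous).continuousOn (fun x hx => ?_)
    (hf.integrable_flux hF).intervalIntegrable
  rw [mul_comm]
  exact (hF.hasDerivAt_rootPrimitive (f x)).comp x (hd x hx.2).hasDerivAt

theorem integral_flux (hF : IsDoubleWell F) (hf : IsTransition F f) :
    ∫ x, deriv f x * signedRoot F (f x) = surfaceTension F := by
  have h₁ := intervalIntegral_tendsto_integral (hf.integrable_flux hF) tendsto_neg_atTop_atBot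
    tendsto_id
  have h₂ : Tendsto (fun R => rootPrimitive F (f R) - rootPrimitive F (f (-R))) atTop
      (𝓝 (rootPrimitive F 1 - rootPrimitive F (-1))) :=
    ((hF.continuous_rootPrimitive.tendsto _).comp hf.tendsto_atTop).sub
      ((hF.continuous_rootPrimitive.tendsto _).comp
        (hf.tendsto_atBot.comp tendsto_neg_atTop_atBot))
  rw [← hF.rootPrimitive_one_sub]
  refine tendsto_nhds_unique (h₁.congr' ?_) h₂
  filter_upwards [eventually_ge_atTop 0] with R hR
  exact hf.integral_flux_interval hF (by simp only [id]; linarith)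

theorem integrable_residual_sq (hF : IsDoubleWell F) (hf : IsTransition F f) :
    Integrable fun x => residual F f x ^ 2 := by
  simp only [residual_sq hF]
  exact (hf.integrable.const_mul 2).sub ((hf.integrable_flux hF).const_mul 2)

/-- Completing the square: the excess energy is half the squared norm of the residual, since the
mixed term integrates to `surfaceTension F`. -/
theorem integral_residual_sq (hF : IsDoubleWell F) (hf : IsTransition F f) :
    ∫ x, residual F f x ^ 2 = 2 * lineExcess F f := by
  simp only [residual_sq hF]
  rw [integral_sub (hf.integrable.const_mul 2) ((hf.integrable_flux hF).const_mul 2),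
    integral_const_mul, integral_const_mul, hf.integral_flux hF, lineExcess]
  ring

theorem lineExcess_nonneg (hF : IsDoubleWell F) (hf : IsTransition F f) :
    0 ≤ lineExcess F f := by
  have : 0 ≤ ∫ x, residual F f x ^ 2 := integral_nonneg fun x => sq_nonneg _
  rw [hf.integral_residual_sq hF] at this
  linarith

/-- Moving against the flow of `u' = signedRoot F u` costs energy: the squared residual is at least
`-4 f' signedRoot F (f)`, whose integral depends on the end values only. -/
theorem rootPrimitive_sub_le (hF : IsDoubleWell F) (hf : IsTransition F f) {a b : ℝ}
    (hab : a ≤ b) :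
    rootPrimitive F (f a) - rootPrimitive F (f b) ≤ lineExcess F f / 2 := by
  have h₁ := (hf.integrable_residual_sq hF).intervalIntegral_le_integral
    (fun x => sq_nonneg _) hab
  have h₂ : ∫ x in a..b, -4 * (deriv f x * signedRoot F (f x)) ≤
      ∫ x in a..b, residual F f x ^ 2 := by
    refine intervalIntegral.integral_mono_on hab
      ((hf.integrable_flux hF).const_mul (-4)).intervalIntegrable
      (hf.integrable_residual_sq hF).intervalIntegrable fun x _ => ?_
    rw [residual]
    nlinarith [sq_nonneg (deriv f x + signedRoot F (f x))]
  rw [intervalIntegral.integral_const_mul, hf.integral_flux_interval hF hab] at h₂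
  rw [hf.integral_residual_sq hF] at h₁
  linarith

/-- A transition of small excess energy starting at `0` stays above a given negative level. -/
theorem lt_of_lineExcess_le (hF : IsDoubleWell F) (hf : IsTransition F f) (h0 : f 0 = 0) {c : ℝ}
    (hc0 : 0 < c) (hc1 : c ≤ 1) (hε : lineExcess F f ≤ rootPrimitive F c) {x : ℝ} (hx : 0 ≤ x) :
    -c < f x := by
  by_contra! h
  obtain ⟨z, hz, hfz⟩ := intermediate_value_Icc' hx hf.continuous.continuousOn
    (show -c ∈ Icc (f x) (f 0) from ⟨h, by linarith⟩)
  have h₁ := hf.rootPrimitive_sub_le hF hz.1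
  have h₂ := hF.strictMonoOn_rootPrimitive (by norm_num) ⟨by linarith, hc1⟩ hc0
  have h₃ : rootPrimitive F 0 = 0 := by simp [rootPrimitive]
  rw [h0, hfz, hF.rootPrimitive_neg_arg] at h₁
  linarith

/-- A transition of small excess energy starting at `0` stays below the level `2`. -/
theorem lt_two_of_lineExcess_le (hF : IsDoubleWell F) (hf : IsTransition F f) (h0 : f 0 = 0)
    (hε : lineExcess F f ≤ rootPrimitive F 1 - rootPrimitive F 2) {x : ℝ} (hx : 0 ≤ x) :
    f x < 2 := by
  by_contra! h
  obtain ⟨z, hz, hfz⟩ := intermediate_value_Icc hx hf.continuous.continuousOn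
    (show (2 : ℝ) ∈ Icc (f 0) (f x) from ⟨by linarith, h⟩)
  obtain ⟨w, hw, hfw⟩ := intermediate_value_Icc hz.1 hf.continuous.continuousOn
    (show (1 : ℝ) ∈ Icc (f 0) (f z) from ⟨by linarith, by linarith⟩)
  have h₁ := hf.rootPrimitive_sub_le hF hw.2
  have h₂ := hF.strictAntiOn_rootPrimitive (by norm_num : (1 : ℝ) ∈ Ici 1)
    (by norm_num : (2 : ℝ) ∈ Ici 1) (by norm_num)
  rw [hfz, hfw] at h₁
  linarith

end IsTransition

/-- The flow of `u' = signedRoot F u` contracts the distance between any `u ∈ [-a/2, 2]` and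
`w ∈ [a, 1]`, at a uniform rate, although the signed root increases on `[-a/2, 0]`: being even,
it is at least its value at `a/2` there. -/
theorem IsDoubleWell.exists_signedRoot_sub_mul_le {F : ℝ → ℝ} (hF : IsDoubleWell F) {a : ℝ}
    (ha : 0 < a) : ∃ κ, 0 < κ ∧ ∀ u w, -(a / 2) ≤ u → u ≤ 2 → a ≤ w → w ≤ 1 →
      (signedRoot F u - signedRoot F w) * (u - w) ≤ -κ * (u - w) ^ 2 := by
  obtain ⟨κ, hκ, hdec⟩ := hF.exists_signedRoot_sub_le (a := a / 2) (b := 2) (by linarith)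
  have hanti : AntitoneOn (signedRoot F) (Ici 0) := by
    refine antitoneOn_of_deriv_nonpos (convex_Ici _) hF.continuous_signedRoot.continuousOn
      (fun x _ => (hF.hasDerivAt_signedRoot x).differentiableAt.differentiableWithinAt)
      fun x hx => ?_
    rw [interior_Ici] at hx
    rw [(hF.hasDerivAt_signedRoot x).deriv]
    exact (hF.rootSlope_neg hx).le
  refine ⟨κ / 3, by positivity, fun u w h₁ h₂ h₃ h₄ => ?_⟩
  rcases le_or_gt (a / 2) u with hu | hu
  · rcases le_total u w with huw | huw
    · have := hdec u w hu huw (by linarith)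
      nlinarith [sq_nonneg (u - w), mul_nonneg hκ.le (sq_nonneg (u - w))]
    · have := hdec w u (by linarith) huw h₂
      nlinarith [sq_nonneg (u - w), mul_nonneg hκ.le (sq_nonneg (u - w))]
  · have e₁ : signedRoot F (a / 2) ≤ signedRoot F u := by
      have h : |u| ≤ a / 2 := abs_le.2 ⟨h₁, hu.le⟩
      have h' : signedRoot F |u| = signedRoot F u := by
        rcases abs_choice u with h | h <;> simp [h, hF.signedRoot_neg_arg]
      rw [← h']
      exact hanti (abs_nonneg u) (by simp only [mem_Ici]; linarith) h
    have e₂ := hdec (a / 2) w le_rfl (by linarith) (by linarith)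
    -- `w - a / 2` is at least a third of `w - u`, since `u ≥ -a / 2` and `w ≥ a`
    have e₃ : κ / 3 * (w - u) ≤ signedRoot F u - signedRoot F w := by nlinarith
    nlinarith

namespace IsTransition

variable {F f m : ℝ → ℝ}

theorem hasDerivAt_sub_sq (hm : IsProfile F m) {x : ℝ} (hd : DifferentiableAt ℝ f x) :
    HasDerivAt (fun x => (f x - m x) ^ 2)
      (2 * (f x - m x) * (signedRoot F (f x) - signedRoot F (m x) + residual F f x)) x := by
  have := (hd.hasDerivAt.fun_sub (hm.hasDerivAt_signedRoot x)).fun_pow 2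
  refine this.congr_deriv ?_
  simp only [residual]
  ring

theorem intervalIntegrable_residual (hF : IsDoubleWell F) (hf : IsTransition F f) (a b : ℝ) :
    IntervalIntegrable (residual F f) volume a b := by
  have h : IntervalIntegrable (fun x => 1 + residual F f x ^ 2) volume a b :=
    intervalIntegrable_const.add (hf.integrable_residual_sq hF).intervalIntegrable
  refine h.mono_fun' ((measurable_deriv f).sub
    (hF.continuous_signedRoot.comp hf.continuous).measurable).aestronglyMeasurable
    (Eventually.of_forall fun x => ?_)
  change |residual F f x| ≤ 1 + residual F f x ^ 2
  rw [abs_le]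
  constructor <;> nlinarith [sq_nonneg (residual F f x - 1), sq_nonneg (residual F f x + 1)]

theorem intervalIntegrable_deriv_sub_sq (hF : IsDoubleWell F) (hm : IsProfile F m)
    (hf : IsTransition F f) (a b : ℝ) :
    IntervalIntegrable (fun x => 2 * (f x - m x) *
      (signedRoot F (f x) - signedRoot F (m x) + residual F f x)) volume a b := by
  have hc : Continuous fun x => 2 * (f x - m x) :=
    continuous_const.mul (hf.continuous.sub hm.continuous)
  have hc' : Continuous fun x => signedRoot F (f x) - signedRoot F (m x) :=
    (hF.continuous_signedRoot.comp hf.continuous).sub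
      (hF.continuous_signedRoot.comp hm.continuous)
  exact ((hc'.intervalIntegrable a b).add (hf.intervalIntegrable_residual hF a b)).continuousOn_mul
    hc.continuousOn

/-- Grönwall's inequality for the distance to the profile on `[0, 1]`, where the profile is too
close to `0` for the flow to contract. -/
theorem sub_sq_le_of_le_one (hF : IsDoubleWell F) (hm : IsProfile F m) (hf : IsTransition F f)
    (h0 : f 0 = 0) {K : ℝ} (hK : 0 < K)
    (hLip : ∀ x, 0 ≤ x → |signedRoot F (f x) - signedRoot F (m x)| ≤ K * |f x - m x|) {x : ℝ}
    (hx0 : 0 ≤ x) (hx1 : x ≤ 1) :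
    (f x - m x) ^ 2 ≤ Real.exp (2 * K + 1) * (2 * lineExcess F f) := by
  obtain ⟨s, hs, hd⟩ := hf.differentiableAt
  set L := 2 * K + 1 with hL
  have hexp : ∀ x, HasDerivAt (fun x => Real.exp (-(L * x))) (Real.exp (-(L * x)) * -L) x :=
    fun x => by simpa using ((hasDerivAt_id x).const_mul L).neg.exp
  have hcexp : Continuous fun x => Real.exp (-(L * x)) := by fun_prop
  have hcg : Continuous fun x => (f x - m x) ^ 2 := (hf.continuous.sub hm.continuous).pow 2
  have key := sub_le_integral_of_hasDerivAt_off_countable (φ := fun x => residual F f x ^ 2)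
    (g := fun x => Real.exp (-(L * x)) * (f x - m x) ^ 2)
    (g' := fun x => Real.exp (-(L * x)) * -L * (f x - m x) ^ 2 + Real.exp (-(L * x)) *
      (2 * (f x - m x) * (signedRoot F (f x) - signedRoot F (m x) + residual F f x)))
    hx0 hs (hcexp.mul hcg).continuousOn
    (fun y hy => (hexp y).mul (hasDerivAt_sub_sq hm (hd y hy.2))) ?_
    (hf.integrable_residual_sq hF).intervalIntegrable ?_
  · have hle := (hf.integrable_residual_sq hF).intervalIntegral_le_integral
      (fun x => sq_nonneg _) hx0
    rw [hf.integral_residual_sq hF] at hle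
    simp only [h0, hm.zero, sub_self, mul_zero, neg_zero, ne_eq, OfNat.ofNat_ne_zero,
      not_false_eq_true, zero_pow, sub_zero] at key
    have h1 : Real.exp (-(L * x)) * (f x - m x) ^ 2 ≤ 2 * lineExcess F f := key.trans hle
    have hpos := hf.lineExcess_nonneg hF
    calc (f x - m x) ^ 2 = Real.exp (L * x) * (Real.exp (-(L * x)) * (f x - m x) ^ 2) := by
          rw [← mul_assoc, ← Real.exp_add]; simp
      _ ≤ Real.exp L * (2 * lineExcess F f) := by
          refine mul_le_mul (Real.exp_le_exp.2 ?_) h1 (by positivity) (Real.exp_pos _).le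
          nlinarith
  · refine IntervalIntegrable.add ?_ ?_
    · exact Continuous.intervalIntegrable ((hcexp.mul continuous_const).mul hcg) _ _
    · exact (hf.intervalIntegrable_deriv_sub_sq hF hm 0 x).continuousOn_mul hcexp.continuousOn
  · intro y hy
    have h1 : Real.exp (-(L * y)) ≤ 1 := Real.exp_le_one_iff.2 (by
      have := mul_nonneg (show 0 ≤ L by linarith) hy.1; linarith)
    have h2 := Real.exp_pos (-(L * y))
    have h3 : (f y - m y) * (signedRoot F (f y) - signedRoot F (m y)) ≤ K * (f y - m y) ^ 2 := by
      refine (le_abs_self _).trans ?_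
      rw [abs_mul, ← sq_abs (f y - m y)]
      nlinarith [hLip y hy.1, abs_nonneg (f y - m y)]
    have h4 : -L * (f y - m y) ^ 2 +
        2 * (f y - m y) * (signedRoot F (f y) - signedRoot F (m y) + residual F f y) ≤
        residual F f y ^ 2 := by
      nlinarith [sq_nonneg (f y - m y - residual F f y)]
    calc _ = Real.exp (-(L * y)) * (-L * (f y - m y) ^ 2 +
        2 * (f y - m y) * (signedRoot F (f y) - signedRoot F (m y) + residual F f y)) := by ring
      _ ≤ Real.exp (-(L * y)) * residual F f y ^ 2 := mul_le_mul_of_nonneg_left h4 h2.le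
      _ ≤ residual F f y ^ 2 := mul_le_of_le_one_left (sq_nonneg _) h1

/-- Beyond `x = 1` the flow contracts, so that the distance to the profile is controlled by its
value at `1` and by the residual. -/
theorem integral_sub_sq_le_of_one_le (hF : IsDoubleWell F) (hm : IsProfile F m)
    (hf : IsTransition F f) {κ : ℝ} (hκ : 0 < κ)
    (hdec : ∀ x, 1 ≤ x →
      (signedRoot F (f x) - signedRoot F (m x)) * (f x - m x) ≤ -κ * (f x - m x) ^ 2)
    {R : ℝ} (hR : 1 ≤ R) :
    κ * ∫ x in (1 : ℝ)..R, (f x - m x) ^ 2 ≤ (f 1 - m 1) ^ 2 + κ⁻¹ * (2 * lineExcess F f) := by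
  obtain ⟨s, hs, hd⟩ := hf.differentiableAt
  have hcg : Continuous fun x => (f x - m x) ^ 2 := (hf.continuous.sub hm.continuous).pow 2
  have hi₁ : IntervalIntegrable (fun x => -κ * (f x - m x) ^ 2) volume 1 R :=
    (continuous_const.mul hcg).intervalIntegrable _ _
  have hi₂ : IntervalIntegrable (fun x => κ⁻¹ * residual F f x ^ 2) volume 1 R :=
    ((hf.integrable_residual_sq hF).const_mul _).intervalIntegrable
  have key := sub_le_integral_of_hasDerivAt_off_countable (g := fun x => (f x - m x) ^ 2)
    (φ := fun x => -κ * (f x - m x) ^ 2 + κ⁻¹ * residual F f x ^ 2)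
    hR hs hcg.continuousOn (fun y hy => hasDerivAt_sub_sq hm (hd y hy.2))
    (hf.intervalIntegrable_deriv_sub_sq hF hm 1 R) (hi₁.add hi₂) fun y hy => by
      have h1 := hdec y hy.1
      have h2 : 2 * (f y - m y) * residual F f y ≤
          κ * (f y - m y) ^ 2 + κ⁻¹ * residual F f y ^ 2 := by
        have : κ * (f y - m y) ^ 2 + κ⁻¹ * residual F f y ^ 2 -
            2 * (f y - m y) * residual F f y = κ⁻¹ * (κ * (f y - m y) - residual F f y) ^ 2 := by
          field_simp
          ring
        have h' : 0 ≤ κ⁻¹ * (κ * (f y - m y) - residual F f y) ^ 2 := by positivity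
        linarith
      nlinarith
  rw [intervalIntegral.integral_add hi₁ hi₂, intervalIntegral.integral_const_mul,
    intervalIntegral.integral_const_mul] at key
  have hle := (hf.integrable_residual_sq hF).intervalIntegral_le_integral
    (fun x => sq_nonneg _) hR
  rw [hf.integral_residual_sq hF] at hle
  have := mul_le_mul_of_nonneg_left hle (inv_pos.2 hκ).le
  nlinarith [sq_nonneg (f R - m R)]

/-- Stability on the half-line to the right of the zero of `f`. -/
theorem exists_intervalIntegral_sub_sq_le (hF : IsDoubleWell F) (hm : IsProfile F m) :
    ∃ ε C : ℝ, 0 < ε ∧ 0 < C ∧ ∀ f, IsTransition F f → f 0 = 0 → lineExcess F f ≤ ε →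
      ∀ R, 1 ≤ R → ∫ x in (0 : ℝ)..R, (f x - m x) ^ 2 ≤ C * lineExcess F f := by
  have ha : 0 < m 1 := hm.pos hF one_pos
  have hm1 : ∀ x, m x ≤ 1 := fun x => (abs_le.1 (hm.abs_le_one x)).2
  obtain ⟨κ, hκ, hdec⟩ := hF.exists_signedRoot_sub_mul_le ha
  obtain ⟨K, hK, hLip⟩ := hF.exists_abs_signedRoot_sub_le 2
  have hz : rootPrimitive F 0 = 0 := by simp [rootPrimitive]
  have hε₁ := hF.strictMonoOn_rootPrimitive (by norm_num : (0 : ℝ) ∈ Icc (-1) 1)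
    (⟨by linarith, by linarith [hm1 1]⟩ : m 1 / 2 ∈ Icc (-1 : ℝ) 1) (by linarith)
  have hε₂ := hF.strictAntiOn_rootPrimitive (by norm_num : (1 : ℝ) ∈ Ici 1)
    (by norm_num : (2 : ℝ) ∈ Ici 1) (by norm_num)
  set E := Real.exp (2 * K + 1)
  have hE : 0 < E := Real.exp_pos _
  refine ⟨min (rootPrimitive F (m 1 / 2)) (rootPrimitive F 1 - rootPrimitive F 2),
    2 * E + κ⁻¹ * (2 * E + κ⁻¹ * 2), lt_min (by linarith) (by linarith), by positivity, ?_⟩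
  intro f hf h0 hε R hR
  have hlow : ∀ x, 0 ≤ x → -(m 1 / 2) < f x := fun x hx =>
    hf.lt_of_lineExcess_le hF h0 (by linarith) (by linarith [hm1 1])
      (hε.trans (min_le_left _ _)) hx
  have hup : ∀ x, 0 ≤ x → f x < 2 := fun x hx =>
    hf.lt_two_of_lineExcess_le hF h0 (hε.trans (min_le_right _ _)) hx
  have hcg : Continuous fun x => (f x - m x) ^ 2 := (hf.continuous.sub hm.continuous).pow 2
  have hnear : ∀ x, 0 ≤ x → x ≤ 1 → (f x - m x) ^ 2 ≤ E * (2 * lineExcess F f) := fun x h1 h2 =>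
    hf.sub_sq_le_of_le_one hF hm h0 hK (fun y hy => hLip _ _
      (abs_le.2 ⟨by linarith [hlow y hy, hm1 1], (hup y hy).le⟩)
      ((hm.abs_le_one y).trans one_le_two)) h1 h2
  have hfar := hf.integral_sub_sq_le_of_one_le hF hm hκ (fun x hx => hdec _ _
    (hlow x (by linarith)).le (hup x (by linarith)).le (hm.monotone hx) (hm1 x)) hR
  have hone : ∫ x in (0 : ℝ)..1, (f x - m x) ^ 2 ≤ E * (2 * lineExcess F f) := by
    have := intervalIntegral.integral_mono_on (zero_le_one' ℝ) (hcg.intervalIntegrable 0 1)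
      (intervalIntegrable_const (μ := volume) (c := E * (2 * lineExcess F f)))
      fun x hx => hnear x hx.1 hx.2
    simpa using this
  rw [← intervalIntegral.integral_add_adjacent_intervals (hcg.intervalIntegrable 0 1)
    (hcg.intervalIntegrable 1 R)]
  have h1 := hnear 1 zero_le_one le_rfl
  have hfar' : ∫ x in (1 : ℝ)..R, (f x - m x) ^ 2 ≤
      κ⁻¹ * (E * (2 * lineExcess F f) + κ⁻¹ * (2 * lineExcess F f)) := by
    rw [← div_eq_inv_mul, le_div_iff₀ hκ]
    linarith
  calc _ ≤ E * (2 * lineExcess F f) +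
        κ⁻¹ * (E * (2 * lineExcess F f) + κ⁻¹ * (2 * lineExcess F f)) := add_le_add hone hfar'
    _ = _ := by ring

/-- Stability of the profile on the line: a transition of small excess energy is close in `L²` to
a translate of the profile, quadratically in terms of the excess. -/
theorem exists_lintegral_sub_sq_le (hF : IsDoubleWell F) (hm : IsProfile F m) :
    ∃ ε C : ℝ, 0 < ε ∧ 0 < C ∧ ∀ f, IsTransition F f → lineExcess F f ≤ ε →
      ∃ ξ, ∫⁻ x, ENNReal.ofReal ((f x - m (x - ξ)) ^ 2) ≤
        ENNReal.ofReal (C * lineExcess F f) := by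
  obtain ⟨ε₁, C₁, hε₁, hC₁, H₁⟩ := exists_intervalIntegral_sub_sq_le hF hm
  obtain ⟨ε₂, C₂, hε₂, hC₂, H₂⟩ := exists_intervalIntegral_sub_sq_le hF (hm.reflect hF)
  refine ⟨min ε₁ ε₂, C₁ + C₂, lt_min hε₁ hε₂, by positivity, fun f hf hε => ?_⟩
  obtain ⟨ξ, hξ⟩ : ∃ ξ, f ξ = 0 := by
    have h1 := (hf.tendsto_atBot.eventually_lt_const (show (-1 : ℝ) < 0 by norm_num)).exists
    have h2 := (hf.tendsto_atTop.eventually_const_lt (show (0 : ℝ) < 1 by norm_num)).exists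
    obtain ⟨a, ha⟩ := h1
    obtain ⟨b, hb⟩ := h2
    exact mem_range_of_exists_le_of_exists_ge hf.continuous ⟨a, ha.le⟩ ⟨b, hb.le⟩
  refine ⟨ξ, ?_⟩
  rw [← lintegral_add_right_eq_self _ ξ]
  simp only [add_sub_cancel_right]
  have hg := hf.translate ξ
  rw [← lineExcess_translate f ξ] at hε ⊢
  have hg0 : (fun x => f (x + ξ)) 0 = 0 := by simpa using hξ
  change ∫⁻ x, ENNReal.ofReal (((fun x => f (x + ξ)) x - m x) ^ 2) ≤ _
  generalize (fun x => f (x + ξ)) = g at hg hε hg0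
  have hcg : Continuous fun x => (g x - m x) ^ 2 := (hg.continuous.sub hm.continuous).pow 2
  have hint : ∀ R, 1 ≤ R → ∫ x in (-R)..R, (g x - m x) ^ 2 ≤ (C₁ + C₂) * lineExcess F g := by
    intro R hR
    have h₁ := H₁ g hg hg0 (hε.trans (min_le_left _ _)) R hR
    have h₂ := H₂ _ (hg.reflect hF) (by simp [hg0])
      (by rw [lineExcess_reflect hF]; exact hε.trans (min_le_right _ _)) R hR
    rw [lineExcess_reflect hF] at h₂
    have h₃ := intervalIntegral.integral_comp_neg (a := 0) (b := R) fun x => (g x - m x) ^ 2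
    have h₄ : ∀ x, (-g (-x) - -m (-x)) ^ 2 = (g (-x) - m (-x)) ^ 2 := fun x => by ring
    simp only [h₄] at h₂
    rw [← intervalIntegral.integral_add_adjacent_intervals (hcg.intervalIntegrable (-R) 0)
      (hcg.intervalIntegrable 0 R)]
    rw [neg_zero] at h₃
    linarith
  have hI : Integrable fun x => (g x - m x) ^ 2 := by
    refine integrable_of_intervalIntegral_norm_bounded (l := atTop) (a := fun R : ℝ => -R)
      (b := fun R : ℝ => R) ((C₁ + C₂) * lineExcess F g)
      (fun R => hcg.integrableOn_Icc.mono_set Ioc_subset_Icc_self)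
      tendsto_neg_atTop_atBot tendsto_id ?_
    filter_upwards [eventually_ge_atTop 1] with R hR
    have : ∀ x, ‖(g x - m x) ^ 2‖ = (g x - m x) ^ 2 := fun x => by
      rw [Real.norm_eq_abs, abs_of_nonneg (sq_nonneg _)]
    simp only [this]
    exact hint R hR
  rw [← ofReal_integral_eq_lintegral_ofReal hI (Eventually.of_forall fun x => sq_nonneg _)]
  refine ENNReal.ofReal_le_ofReal (le_of_tendsto (intervalIntegral_tendsto_integral hI
    tendsto_neg_atTop_atBot tendsto_id) ?_)
  filter_upwards [eventually_ge_atTop 1] with R hR using hint R hR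

end IsTransition

/-! ### Lines meeting a set of finite codimension one measure -/

/-- The projection of `ℝ^{d+1}` to `ℝ^d` forgetting the `j`-th coordinate. -/
def forget {d : ℕ} (j : Fin (d + 1)) (z : Space d) : Fin d → ℝ := fun i => z (j.succAbove i)

/-- The point with `j`-th coordinate `t` and remaining coordinates `w`. -/
noncomputable def insertCoord {d : ℕ} (j : Fin (d + 1)) (t : ℝ) (w : Fin d → ℝ) : Space d :=
  WithLp.toLp 2 (j.insertNth t w : Fin (d + 1) → ℝ)

variable {d : ℕ}

@[simp] theorem insertCoord_apply_self (j : Fin (d + 1)) (t : ℝ) (w : Fin d → ℝ) :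
    insertCoord j t w j = t := by simp [insertCoord]

@[simp] theorem forget_insertCoord (j : Fin (d + 1)) (t : ℝ) (w : Fin d → ℝ) :
    forget j (insertCoord j t w) = w := by
  ext i; simp [forget, insertCoord]

theorem lipschitzWith_forget (j : Fin (d + 1)) : LipschitzWith 1 (forget (d := d) j) := by
  refine LipschitzWith.of_dist_le_mul fun x y => ?_
  rw [NNReal.coe_one, one_mul, dist_pi_le_iff dist_nonneg]
  intro i
  rw [dist_eq_norm, dist_eq_norm]
  exact PiLp.norm_apply_le (x - y) (j.succAbove i)

theorem volume_image_forget_le (j : Fin (d + 1)) (A : Set (Space d)) :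
    volume (forget j '' A) ≤ Measure.hausdorffMeasure (d : ℝ) A := by
  have h := (lipschitzWith_forget j).hausdorffMeasure_image_le (d := d) (Nat.cast_nonneg d) A
  have h' : Measure.hausdorffMeasure ((d : ℕ) : ℝ) = (volume : Measure (Fin d → ℝ)) := by
    have := hausdorffMeasure_pi_real (ι := Fin d)
    rwa [Fintype.card_fin] at this
  rwa [h', ENNReal.coe_one, ENNReal.one_rpow, one_mul] at h

/-- Distinct points are eventually separated by a grid of step `1 / n`. -/
theorem eventually_injOn_floor (t : Finset ℝ) :
    ∀ᶠ n : ℕ in atTop, InjOn (fun x : ℝ => ⌊n * x⌋) t := by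
  have h : ∀ p ∈ t ×ˢ t, ∀ᶠ n : ℕ in atTop, ⌊n * p.1⌋ = ⌊n * p.2⌋ → p.1 = p.2 := by
    intro p _
    by_cases hp : p.1 = p.2
    · exact Eventually.of_forall fun n _ => hp
    · have hpos : 0 < |p.1 - p.2| := abs_pos.2 (sub_ne_zero.2 hp)
      filter_upwards [eventually_ge_atTop ⌈|p.1 - p.2|⁻¹⌉₊] with n hn hfl
      exfalso
      have h1 := Int.abs_sub_lt_one_of_floor_eq_floor hfl
      rw [← mul_sub, abs_mul, Nat.abs_cast] at h1
      have h2 : |p.1 - p.2|⁻¹ ≤ n := Nat.ceil_le.1 hn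
      have := mul_le_mul_of_nonneg_right h2 hpos.le
      rw [inv_mul_cancel₀ hpos.ne'] at this
      linarith
  filter_upwards [(Finset.eventually_all (t ×ˢ t)).2 h] with n hn x hx y hy hxy
  exact hn (x, y) (Finset.mk_mem_product hx hy) hxy

/-- Eilenberg's inequality, qualitatively: almost every line in a coordinate direction meets a set
of finite `d`-dimensional Hausdorff measure in finitely many points. The number of cells of a grid
of step `1 / n` on the line which contain a point of the set has an integral bounded by that
measure, and increases to the number of points. -/
theorem ae_finite_slice (j : Fin (d + 1)) {A : Set (Space d)} (hA : MeasurableSet A)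
    (hfin : Measure.hausdorffMeasure (d : ℝ) A < ∞) :
    ∀ᵐ w : Fin d → ℝ, {t | insertCoord j t w ∈ A}.Finite := by
  set cell : ℕ → ℤ → Set (Space d) := fun n k => A ∩ {z | ⌊n * z j⌋ = k} with hcell
  set N : ℕ → (Fin d → ℝ) → ℝ≥0∞ := fun n w =>
    ∑' k, (toMeasurable volume (forget j '' cell n k)).indicator (fun _ => 1) w with hN
  have hNm : ∀ n, Measurable (N n) := fun n => Measurable.tsum fun k =>
    measurable_const.indicator (measurableSet_toMeasurable _ _)
  have hcellm : ∀ n k, MeasurableSet (cell n k) := fun n k => by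
    refine hA.inter ?_
    have : Measurable fun z : Space d => ⌊n * z j⌋ :=
      Int.measurable_floor.comp (measurable_const.mul (by fun_prop))
    exact this (measurableSet_singleton k)
  have hNle : ∀ n, ∫⁻ w, N n w ≤ Measure.hausdorffMeasure (d : ℝ) A := by
    intro n
    calc ∫⁻ w, N n w = ∑' k, volume (forget j '' cell n k) := by
          rw [hN, lintegral_tsum fun k => (measurable_const.indicator
            (measurableSet_toMeasurable _ _)).aemeasurable]
          refine tsum_congr fun k => ?_
          rw [lintegral_indicator_const (measurableSet_toMeasurable _ _), one_mul,
            measure_toMeasurable]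
      _ ≤ ∑' k, Measure.hausdorffMeasure (d : ℝ) (cell n k) :=
          ENNReal.tsum_le_tsum fun k => volume_image_forget_le j _
      _ ≤ Measure.hausdorffMeasure (d : ℝ) (⋃ k, cell n k) := by
          refine tsum_meas_le_meas_iUnion_of_disjoint _ (hcellm n) fun k l hkl => ?_
          refine Set.disjoint_left.2 fun z hk hl => hkl ?_
          exact hk.2.symm.trans hl.2
      _ ≤ _ := measure_mono (iUnion_subset fun k => inter_subset_left)
  have hlim : ∫⁻ w, liminf (fun n => N n w) atTop ≤ Measure.hausdorffMeasure (d : ℝ) A :=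
    (lintegral_liminf_le hNm).trans
      ((liminf_le_liminf (Eventually.of_forall hNle)).trans_eq (liminf_const _))
  filter_upwards [ae_lt_top (Measurable.liminf hNm) (hlim.trans_lt hfin).ne] with w hw
  by_contra hinf
  have hinf : {t | insertCoord j t w ∈ A}.Infinite := hinf
  refine hw.ne (ENNReal.eq_top_of_forall_nnreal_le fun r => ?_)
  obtain ⟨c, hc⟩ := exists_nat_ge r
  refine (ENNReal.coe_le_coe.2 hc).trans ?_
  obtain ⟨t, hts, htc⟩ := hinf.exists_subset_card_eq c
  refine le_liminf_of_le (by isBoundedDefault) ?_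
  filter_upwards [eventually_injOn_floor t] with n hn
  calc (((c : ℕ) : NNReal) : ℝ≥0∞) = ∑ k ∈ t.image (fun x : ℝ => ⌊n * x⌋), (1 : ℝ≥0∞) := by
        rw [Finset.sum_const, Finset.card_image_of_injOn hn, htc]; simp
    _ ≤ ∑ k ∈ t.image (fun x : ℝ => ⌊n * x⌋),
          (toMeasurable volume (forget j '' cell n k)).indicator (fun _ => 1) w := by
        refine Finset.sum_le_sum fun k hk => ?_
        obtain ⟨x, hx, rfl⟩ := Finset.mem_image.1 hk
        rw [indicator_of_mem]
        exact subset_toMeasurable _ _ ⟨insertCoord j x w, ⟨hts hx, by simp⟩, by simp⟩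
    _ ≤ N n w := ENNReal.sum_le_tsum _

theorem isOpen_domain (d : ℕ) : IsOpen (domain d) := by
  have : domain d = ⋂ i : Fin d, {z : Space d | z i.succ ∈ Ioo (0 : ℝ) 1} := by
    ext z; simp [domain]
  rw [this]
  exact isOpen_iInter_of_finite fun i => isOpen_Ioo.preimage (by fun_prop)

theorem measurableSet_domain (d : ℕ) : MeasurableSet (domain d) := (isOpen_domain d).measurableSet

/-- Almost every line in a coordinate direction meets a set of locally finite codimension one
measure in a countable set. -/
theorem ae_countable_slice (j : Fin (d + 1)) {S : Set (Space d)} (hS : S ⊆ domain d)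
    (hopen : IsOpen (domain d \ S))
    (hfin : ∀ K : Set (Space d), IsCompact K → K ⊆ domain d →
      Measure.hausdorffMeasure (d : ℝ) (S ∩ K) < ∞) :
    ∀ᵐ w : Fin d → ℝ, {t | insertCoord j t w ∈ S}.Countable := by
  obtain ⟨C, hC, hCD, hCU, -⟩ := (isOpen_domain d).exists_iUnion_isClosed
  have hSm : MeasurableSet S := by
    have : S = domain d \ (domain d \ S) := by rw [sdiff_sdiff_cancel_left hS]
    rw [this]
    exact (measurableSet_domain d).diff hopen.measurableSet
  have h : ∀ n m : ℕ, ∀ᵐ w : Fin d → ℝ,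
      {t | insertCoord j t w ∈ S ∩ (C n ∩ Metric.closedBall 0 m)}.Finite := fun n m => by
    refine ae_finite_slice j (hSm.inter ((hC n).measurableSet.inter
      Metric.isClosed_closedBall.measurableSet)) (hfin _ ?_ (inter_subset_left.trans (hCD n)))
    exact (isCompact_closedBall _ _).inter_left (hC n)
  filter_upwards [ae_all_iff.2 fun n => ae_all_iff.2 (h n)] with w hw
  refine (countable_iUnion fun n => countable_iUnion fun m => (hw n m).countable).mono
    fun t ht => ?_
  have : insertCoord j t w ∈ ⋃ n, C n := hCU.symm ▸ hS ht
  obtain ⟨n, hn⟩ := mem_iUnion.1 this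
  obtain ⟨m, hm⟩ := exists_nat_ge ‖insertCoord j t w‖
  exact mem_iUnion.2 ⟨n, mem_iUnion.2 ⟨m, ht, hn, by simpa using hm⟩⟩

/-! ### Coordinates on the cylinder -/

/-- Lebesgue measure on the cube `(0,1)^d`, as a product of probability measures. -/
noncomputable def cubeMeasure (d : ℕ) : Measure (Fin d → ℝ) :=
  Measure.pi fun _ => volume.restrict (Ioo (0 : ℝ) 1)

instance isProbabilityMeasure_restrict_Ioo :
    IsProbabilityMeasure ((volume : Measure ℝ).restrict (Ioo 0 1)) := ⟨by simp⟩

instance (d : ℕ) : IsProbabilityMeasure (cubeMeasure d) := by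
  unfold cubeMeasure; infer_instance

theorem cubeMeasure_eq (d : ℕ) : cubeMeasure d = volume.restrict (cube d) :=
  (Measure.restrict_pi_pi (fun _ : Fin d => (volume : Measure ℝ)) fun _ => Ioo 0 1).symm

theorem measurableSet_cube (d : ℕ) : MeasurableSet (cube d) :=
  MeasurableSet.univ_pi fun _ => measurableSet_Ioo

theorem ae_mem_cube : ∀ᵐ y ∂(cubeMeasure d), y ∈ cube d := by
  rw [cubeMeasure_eq]
  exact ae_restrict_mem (measurableSet_cube d)

@[simp] theorem point_zero (x : ℝ) (y : Fin d → ℝ) : point x y 0 = x := rfl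

@[simp] theorem point_succ (x : ℝ) (y : Fin d → ℝ) (i : Fin d) : point x y i.succ = y i := rfl

theorem point_mem_domain {x : ℝ} {y : Fin d → ℝ} : point x y ∈ domain d ↔ y ∈ cube d := by
  simp [domain, cube]

theorem insertCoord_zero (x : ℝ) (y : Fin d → ℝ) : insertCoord 0 x y = point x y := by
  simp [insertCoord, point, Fin.insertNth_zero']

theorem insertCoord_forget_point (i : Fin d) (t x : ℝ) (y : Fin d → ℝ) :
    insertCoord i.succ t (forget i.succ (point x y)) = point x (Function.update y i t) := by
  ext k
  rcases eq_or_ne k i.succ with rfl | hk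
  · simp
  · obtain ⟨l, rfl⟩ := Fin.exists_succAbove_eq hk
    have h1 : insertCoord i.succ t (forget i.succ (point x y)) (i.succ.succAbove l) =
        point x y (i.succ.succAbove l) :=
      congrFun (forget_insertCoord i.succ t (forget i.succ (point x y))) l
    rw [h1]
    revert hk
    refine Fin.cases (fun _ => rfl) (fun j hk => ?_) (i.succ.succAbove l)
    rw [point_succ, point_succ, Function.update_of_ne (fun h => hk (congrArg Fin.succ h))]

/-- The coordinates `(x, y)` as a measurable equivalence. -/
noncomputable def pointEquiv (d : ℕ) : ℝ × (Fin d → ℝ) ≃ᵐ Space d :=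
  (MeasurableEquiv.piFinSuccAbove (fun _ : Fin (d + 1) => ℝ) 0).symm.trans
    (MeasurableEquiv.toLp 2 (Fin (d + 1) → ℝ))

theorem pointEquiv_apply (p : ℝ × (Fin d → ℝ)) : pointEquiv d p = point p.1 p.2 := by
  simp [pointEquiv, point, Fin.insertNth_zero', Fin.insertNthEquiv]

theorem measurable_point : Measurable fun p : ℝ × (Fin d → ℝ) => point p.1 p.2 := by
  simpa only [← pointEquiv_apply] using (pointEquiv d).measurable

theorem measurePreserving_pointEquiv (d : ℕ) :
    MeasurePreserving (pointEquiv d) (volume.prod (cubeMeasure d)) (domainMeasure d) := by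
  have h : MeasurePreserving (pointEquiv d) (volume.prod volume) volume :=
    (PiLp.volume_preserving_toLp (Fin (d + 1))).comp
      (volume_preserving_piFinSuccAbove (fun _ : Fin (d + 1) => ℝ) 0).symm
  have h' := h.restrict_preimage_emb (pointEquiv d).measurableEmbedding (domain d)
  have hpre : pointEquiv d ⁻¹' domain d = univ ×ˢ cube d := by
    ext p; simp [pointEquiv_apply, point_mem_domain]
  rw [hpre, ← Measure.prod_restrict, Measure.restrict_univ, ← cubeMeasure_eq] at h'
  exact h'

theorem lintegral_domainMeasure (g : Space d → ℝ≥0∞) :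
    ∫⁻ z, g z ∂(domainMeasure d) =
      ∫⁻ p, g (point p.1 p.2) ∂(volume.prod (cubeMeasure d)) := by
  rw [(measurePreserving_pointEquiv d).lintegral_map_equiv]
  simp only [pointEquiv_apply]

theorem ae_point_of_ae {P : Space d → Prop} (h : ∀ᵐ z ∂(domainMeasure d), P z) :
    ∀ᵐ p ∂(volume.prod (cubeMeasure d)), P (point p.1 p.2) := by
  simpa only [pointEquiv_apply] using
    (measurePreserving_pointEquiv d).quasiMeasurePreserving.ae h

/-- A property of the remaining coordinates valid almost everywhere is valid almost everywhere on
the cylinder. -/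
theorem ae_domainMeasure_forget (j : Fin (d + 1)) {P : (Fin d → ℝ) → Prop}
    (h : ∀ᵐ w, P w) : ∀ᵐ z ∂(domainMeasure d), P (forget j z) := by
  refine ae_restrict_of_ae ?_
  have hq := Measure.quasiMeasurePreserving_snd.comp
    ((volume_preserving_piFinSuccAbove (fun _ : Fin (d + 1) => ℝ) j).comp
      (PiLp.volume_preserving_ofLp (Fin (d + 1)))).quasiMeasurePreserving
  exact hq.ae h

/-! ### A Poincaré inequality on the cube -/

/-- Exchanging the coordinates indexed by `s` between two independent points of the cube
preserves their joint law. -/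
theorem measurePreserving_exchange (s : Finset (Fin d)) :
    MeasurePreserving (fun p : (Fin d → ℝ) × (Fin d → ℝ) =>
      (s.piecewise p.2 p.1, s.piecewise p.1 p.2))
      ((cubeMeasure d).prod (cubeMeasure d)) ((cubeMeasure d).prod (cubeMeasure d)) := by
  classical
  set ν := (volume : Measure ℝ).restrict (Ioo 0 1)
  have he := measurePreserving_arrowProdEquivProdArrow ℝ ℝ (Fin d) (fun _ => ν) (fun _ => ν)
  have hf : ∀ i : Fin d, MeasurePreserving
      (if i ∈ s then (Prod.swap : ℝ × ℝ → ℝ × ℝ) else id) (ν.prod ν) (ν.prod ν) := by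
    intro i
    split_ifs
    · exact Measure.measurePreserving_swap
    · exact MeasurePreserving.id _
  have := (he.comp (measurePreserving_pi _ _ hf)).comp he.symm
  change MeasurePreserving _ ((Measure.pi fun _ => ν).prod (Measure.pi fun _ => ν))
    ((Measure.pi fun _ => ν).prod (Measure.pi fun _ => ν))
  convert this using 1
  ext p i
  · by_cases h : i ∈ s <;>
      simp [h, MeasurableEquiv.arrowProdEquivProdArrow, Equiv.arrowProdEquivProdArrow]
  · by_cases h : i ∈ s <;>
      simp [h, MeasurableEquiv.arrowProdEquivProdArrow, Equiv.arrowProdEquivProdArrow]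

theorem measurable_piecewise_update (i : Fin d) :
    Measurable fun p : (Fin d → ℝ) × (Fin d → ℝ) => Function.update p.1 i (p.2 i) :=
  measurable_pi_iff.2 fun k => by
    by_cases h : k = i
    · subst h; simpa using measurable_snd.eval
    · simpa [h] using measurable_fst.eval

theorem lintegral_update (i : Fin d) {Q : (Fin d → ℝ) → ℝ≥0∞} (hQ : Measurable Q) :
    ∫⁻ p, Q (Function.update p.1 i (p.2 i)) ∂((cubeMeasure d).prod (cubeMeasure d)) =
      ∫⁻ y, Q y ∂(cubeMeasure d) := by
  have h := (measurePreserving_exchange {i}).lintegral_comp (hQ.comp measurable_fst)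
  have h' : ∀ p : (Fin d → ℝ) × (Fin d → ℝ),
      ({i} : Finset (Fin d)).piecewise p.2 p.1 = Function.update p.1 i (p.2 i) := fun p =>
    Finset.piecewise_singleton _ _ _
  simp only [Function.comp_def, h'] at h
  rw [h, lintegral_prod (fun b => Q b.1) (hQ.comp measurable_fst).aemeasurable]
  simp

theorem ofReal_sub_sq_le (a b c : ℝ) : ENNReal.ofReal ((a - c) ^ 2) ≤
    2 * ENNReal.ofReal ((a - b) ^ 2) + 2 * ENNReal.ofReal ((b - c) ^ 2) := by
  rw [← ENNReal.ofReal_ofNat 2, ← ENNReal.ofReal_mul zero_le_two, ← ENNReal.ofReal_mul zero_le_two,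
    ← ENNReal.ofReal_add (by positivity) (by positivity)]
  exact ENNReal.ofReal_le_ofReal (by nlinarith [sq_nonneg (a - b - (b - c))])

/-- The mean square change of `H` when the coordinates in `s` are resampled is controlled by the
mean square changes when a single coordinate is resampled. -/
theorem lintegral_sub_piecewise_le {H : (Fin d → ℝ) → ℝ} (hH : Measurable H)
    (s : Finset (Fin d)) :
    ∫⁻ p, ENNReal.ofReal ((H p.1 - H (s.piecewise p.2 p.1)) ^ 2)
        ∂((cubeMeasure d).prod (cubeMeasure d)) ≤
      2 ^ s.card * ∑ i ∈ s, ∫⁻ p, ENNReal.ofReal ((H p.1 - H (Function.update p.1 i (p.2 i))) ^ 2)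
        ∂((cubeMeasure d).prod (cubeMeasure d)) := by
  classical
  set A : Fin d → ℝ≥0∞ := fun i =>
    ∫⁻ p, ENNReal.ofReal ((H p.1 - H (Function.update p.1 i (p.2 i))) ^ 2)
      ∂((cubeMeasure d).prod (cubeMeasure d)) with hA
  induction s using Finset.induction_on with
  | empty => simp
  | insert i s hi ih =>
    have hmix := measurePreserving_exchange s
    have hQ : Measurable fun p : (Fin d → ℝ) × (Fin d → ℝ) =>
        ENNReal.ofReal ((H p.1 - H (Function.update p.1 i (p.2 i))) ^ 2) :=
      (((hH.comp measurable_fst).sub (hH.comp (measurable_piecewise_update i))).pow_const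
        2).ennreal_ofReal
    -- after exchanging the coordinates in `s`, the last step changes the `i`-th coordinate only
    have hstep : ∫⁻ p, ENNReal.ofReal
        ((H (s.piecewise p.2 p.1) - H ((insert i s).piecewise p.2 p.1)) ^ 2)
        ∂((cubeMeasure d).prod (cubeMeasure d)) = A i := by
      simp only [hA]
      rw [← hmix.lintegral_comp hQ]
      refine lintegral_congr fun p => ?_
      simp only [Finset.piecewise_insert, Finset.piecewise_eq_of_notMem _ _ _ hi]
    calc _ ≤ ∫⁻ p, (2 * ENNReal.ofReal ((H p.1 - H (s.piecewise p.2 p.1)) ^ 2) +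
          2 * ENNReal.ofReal ((H (s.piecewise p.2 p.1) -
            H ((insert i s).piecewise p.2 p.1)) ^ 2))
          ∂((cubeMeasure d).prod (cubeMeasure d)) :=
          lintegral_mono fun p => ofReal_sub_sq_le _ _ _
      _ = 2 * (∫⁻ p, ENNReal.ofReal ((H p.1 - H (s.piecewise p.2 p.1)) ^ 2)
          ∂((cubeMeasure d).prod (cubeMeasure d))) + 2 * A i := by
          rw [lintegral_add_left, lintegral_const_mul' _ _ (by simp),
            lintegral_const_mul' _ _ (by simp), hstep]
          exact ((((hH.comp measurable_fst).sub (hH.comp (measurable_fst.comp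
            hmix.measurable))).pow_const 2).ennreal_ofReal).const_mul _
      _ ≤ 2 * (2 ^ s.card * ∑ j ∈ s, A j) + 2 * (2 ^ s.card * A i) := by
          gcongr
          exact le_mul_of_one_le_left zero_le (one_le_pow₀ one_le_two)
      _ = _ := by
          rw [Finset.card_insert_of_notMem hi, Finset.sum_insert hi]
          ring

/-- The mean square difference of the values at two independent points of the cube is controlled by
the mean square changes when a single coordinate is resampled. -/
theorem lintegral_sub_sq_le {H : (Fin d → ℝ) → ℝ} (hH : Measurable H) :
    ∫⁻ y', ∫⁻ y, ENNReal.ofReal ((H y - H y') ^ 2) ∂(cubeMeasure d) ∂(cubeMeasure d) ≤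
      2 ^ d * ∑ i, ∫⁻ p, ENNReal.ofReal ((H p.1 - H (Function.update p.1 i (p.2 i))) ^ 2)
        ∂((cubeMeasure d).prod (cubeMeasure d)) := by
  have h := lintegral_sub_piecewise_le hH Finset.univ
  simp only [Finset.piecewise_univ, Finset.card_univ, Fintype.card_fin] at h
  rwa [lintegral_prod_symm' _ (by fun_prop)] at h

/-- The one-dimensional inequality behind the Poincaré inequality. -/
theorem ofReal_sub_sq_le_lintegral {φ φ' : ℝ → ℝ} {s : Set ℝ} (hs : s.Countable)
    (hφ : ContinuousOn φ (Ioo 0 1)) (hd : ∀ t ∈ Ioo (0 : ℝ) 1 \ s, HasDerivAt φ (φ' t) t)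
    (hm : Measurable φ') {a b : ℝ} (ha : a ∈ Ioo (0 : ℝ) 1) (hb : b ∈ Ioo (0 : ℝ) 1) :
    ENNReal.ofReal ((φ a - φ b) ^ 2) ≤ ∫⁻ t in Ioo 0 1, ENNReal.ofReal (φ' t ^ 2) := by
  wlog hab : a ≤ b generalizing a b
  · rw [show (φ a - φ b) ^ 2 = (φ b - φ a) ^ 2 by ring]
    exact this hb ha (not_le.1 hab).le
  by_cases htop : ∫⁻ t in Ioo 0 1, ENNReal.ofReal (φ' t ^ 2) = ∞
  · rw [htop]; exact le_top
  have hsub : Icc a b ⊆ Ioo 0 1 := fun t ht => ⟨ha.1.trans_le ht.1, ht.2.trans_lt hb.2⟩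
  have hint : IntegrableOn (fun t => φ' t ^ 2) (Ioo 0 1) :=
    (lintegral_ofReal_ne_top_iff_integrable (hm.pow_const 2).aestronglyMeasurable
      (Eventually.of_forall fun t => sq_nonneg _)).1 htop
  have hint₂ : IntervalIntegrable (fun t => φ' t ^ 2) volume a b :=
    (intervalIntegrable_iff_integrableOn_Icc_of_le hab).2 (hint.mono_set hsub)
  have hint₁ : IntervalIntegrable φ' volume a b := by
    have h : IntervalIntegrable (fun t => 1 + φ' t ^ 2) volume a b :=
      intervalIntegrable_const.add hint₂
    refine h.mono_fun' hm.aestronglyMeasurable (Eventually.of_forall fun x => ?_)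
    change |φ' x| ≤ 1 + φ' x ^ 2
    rw [abs_le]
    constructor <;> nlinarith [sq_nonneg (φ' x - 1), sq_nonneg (φ' x + 1)]
  have hftc := integral_eq_of_hasDerivAt_off_countable_of_le φ φ' hab hs (hφ.mono hsub)
    (fun t ht => hd t ⟨hsub (Ioo_subset_Icc_self ht.1), ht.2⟩) hint₁
  rw [← ofReal_integral_eq_lintegral_ofReal hint (Eventually.of_forall fun t => sq_nonneg _)]
  refine ENNReal.ofReal_le_ofReal ?_
  have hle : ∫ t in a..b, φ' t ^ 2 ≤ ∫ t in Ioo 0 1, φ' t ^ 2 := by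
    rw [intervalIntegral.integral_of_le hab]
    exact setIntegral_mono_set hint (Eventually.of_forall fun t => sq_nonneg _)
      (Ioc_subset_Icc_self.trans hsub).eventuallyLE
  -- expanding this square bounds the squared increment, as `b - a ≤ 1`
  have hvar : 0 ≤ ∫ t in a..b, (φ' t ^ 2 - 2 * (φ b - φ a) * φ' t + (φ b - φ a) ^ 2) :=
    intervalIntegral.integral_nonneg hab fun t _ => by nlinarith [sq_nonneg (φ' t - (φ b - φ a))]
  rw [intervalIntegral.integral_add (hint₂.sub (hint₁.const_mul _)) intervalIntegrable_const,
    intervalIntegral.integral_sub hint₂ (hint₁.const_mul _), intervalIntegral.integral_const_mul,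
    hftc, intervalIntegral.integral_const, smul_eq_mul] at hvar
  nlinarith [sq_nonneg (φ b - φ a), ha.1, hb.2]

/-! ### Lower bound of the energy by the distance to the profiles -/

variable {F : ℝ → ℝ}

theorem hasDerivAt_insertCoord (j : Fin (d + 1)) (t : ℝ) (w : Fin d → ℝ) :
    HasDerivAt (fun t => insertCoord j t w) (EuclideanSpace.single j (1 : ℝ)) t := by
  have h : (fun t : ℝ => insertCoord j t w) =
      fun t => insertCoord j 0 w + t • EuclideanSpace.single j (1 : ℝ) := by
    ext t k
    rcases eq_or_ne k j with rfl | hk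
    · simp
    · obtain ⟨l, rfl⟩ := Fin.exists_succAbove_eq hk
      simp [insertCoord]
  rw [h]
  simpa using ((hasDerivAt_id t).smul_const (EuclideanSpace.single j (1 : ℝ))).const_add
    (insertCoord j 0 w)

theorem fderiv_single_eq_gradient (h : Space d → ℝ) (z : Space d) (j : Fin (d + 1)) :
    fderiv ℝ h z (EuclideanSpace.single j (1 : ℝ)) = gradient h z j := by
  rw [← inner_gradient_left, EuclideanSpace.inner_single_right]
  simp

theorem hasDerivAt_comp_insertCoord {h : Space d → ℝ} {j : Fin (d + 1)} {t : ℝ}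
    {w : Fin d → ℝ} (hd : DifferentiableAt ℝ h (insertCoord j t w)) :
    HasDerivAt (fun t => h (insertCoord j t w)) (gradient h (insertCoord j t w) j) t := by
  rw [← fderiv_single_eq_gradient]
  exact hd.hasFDerivAt.comp_hasDerivAt t (hasDerivAt_insertCoord j t w)

theorem continuous_insertCoord (j : Fin (d + 1)) (w : Fin d → ℝ) :
    Continuous fun t => insertCoord j t w :=
  continuous_iff_continuousAt.2 fun t => (hasDerivAt_insertCoord j t w).continuousAt

theorem measurable_gradient (h : Space d → ℝ) : Measurable (gradient h) :=
  (InnerProductSpace.toDual ℝ (Space d)).symm.continuous.measurable.comp (measurable_fderiv ℝ h)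

@[fun_prop]
theorem measurable_gradient_apply (h : Space d → ℝ) (j : Fin (d + 1)) :
    Measurable fun z => gradient h z j :=
  (EuclideanSpace.proj (𝕜 := ℝ) j).continuous.measurable.comp (measurable_gradient h)

theorem norm_sq_eq_sum (g : Space d) : ‖g‖ ^ 2 = g 0 ^ 2 + ∑ i : Fin d, g i.succ ^ 2 := by
  rw [EuclideanSpace.real_norm_sq_eq, Fin.sum_univ_succ]

/-- On almost every line in the `i`-th direction of the cube, the oscillation of a piecewise
differentiable function is bounded by the square integral of its partial derivative. -/
theorem PiecewiseDifferentiable.ae_sub_update_sq_le {h : Space d → ℝ}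
    (hh : PiecewiseDifferentiable h) (i : Fin d) :
    ∀ᵐ p ∂((volume : Measure ℝ).prod (cubeMeasure d)), ∀ t ∈ Ioo (0 : ℝ) 1,
      ENNReal.ofReal ((h (point p.1 p.2) - h (point p.1 (Function.update p.2 i t))) ^ 2) ≤
        ∫⁻ τ in Ioo 0 1,
          ENNReal.ofReal (gradient h (point p.1 (Function.update p.2 i τ)) i.succ ^ 2) := by
  obtain ⟨hc, S, hSD, hSo, hSf, hd⟩ := hh
  have hcount := ae_point_of_ae (ae_domainMeasure_forget i.succ
    (ae_countable_slice i.succ hSD hSo hSf))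
  have hcube : ∀ᵐ p ∂((volume : Measure ℝ).prod (cubeMeasure d)), p.2 ∈ cube d :=
    Measure.quasiMeasurePreserving_snd.ae ae_mem_cube
  filter_upwards [hcount, hcube] with p hp hp2 t ht
  set w := forget i.succ (point p.1 p.2)
  have hpt : ∀ τ, point p.1 (Function.update p.2 i τ) = insertCoord i.succ τ w := fun τ =>
    (insertCoord_forget_point i τ p.1 p.2).symm
  have hmem : ∀ τ ∈ Ioo (0 : ℝ) 1, insertCoord i.succ τ w ∈ domain d := by
    intro τ hτ
    rw [← hpt, point_mem_domain]
    intro k _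
    rcases eq_or_ne k i with rfl | hk
    · simpa using hτ
    · simpa [hk] using hp2 k (mem_univ k)
  have hself : point p.1 p.2 = insertCoord i.succ (p.2 i) w := by
    rw [← hpt, Function.update_eq_self]
  simp only [hpt]
  rw [hself]
  refine ofReal_sub_sq_le_lintegral (φ := fun τ => h (insertCoord i.succ τ w))
    (φ' := fun τ => gradient h (insertCoord i.succ τ w) i.succ) hp
    (hc.comp (continuous_insertCoord _ _).continuousOn hmem)
    (fun τ hτ => hasDerivAt_comp_insertCoord (hd _ ⟨hmem τ hτ.1, hτ.2⟩))
    ((measurable_gradient_apply h i.succ).comp (continuous_insertCoord _ _).measurable)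
    (hp2 i (mem_univ i)) ht

/-- The mean square difference of the slices `x ↦ h (x, y)` at two points `y` of the cube is
controlled by the derivatives in the directions of the cube. -/
theorem PiecewiseDifferentiable.lintegral_sub_sq_le {h : Space d → ℝ}
    (hh : PiecewiseDifferentiable h) (hm : Measurable h) :
    ∫⁻ y', ∫⁻ x : ℝ, ∫⁻ y, ENNReal.ofReal ((h (point x y) - h (point x y')) ^ 2)
        ∂(cubeMeasure d) ∂volume ∂(cubeMeasure d) ≤
      2 ^ d * ∑ i : Fin d, ∫⁻ p, ENNReal.ofReal (gradient h (point p.1 p.2) i.succ ^ 2)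
        ∂((volume : Measure ℝ).prod (cubeMeasure d)) := by
  have hmp : Measurable fun p : ℝ × (Fin d → ℝ) => h (point p.1 p.2) := hm.comp measurable_point
  have hmx : ∀ x, Measurable fun y : Fin d → ℝ => h (point x y) := fun x =>
    hmp.comp measurable_prodMk_left
  have hm3 : Measurable fun q : ((Fin d → ℝ) × ℝ) × (Fin d → ℝ) =>
      ENNReal.ofReal ((h (point q.1.2 q.2) - h (point q.1.2 q.1.1)) ^ 2) :=
    (((hmp.comp (measurable_fst.snd.prodMk measurable_snd)).sub
      (hmp.comp (measurable_fst.snd.prodMk measurable_fst.fst))).pow_const 2).ennreal_ofReal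
  have hmi : ∀ i : Fin d, Measurable fun q : ℝ × ((Fin d → ℝ) × (Fin d → ℝ)) =>
      ENNReal.ofReal ((h (point q.1 q.2.1) -
        h (point q.1 (Function.update q.2.1 i (q.2.2 i)))) ^ 2) := fun i =>
    (((hmp.comp (measurable_fst.prodMk measurable_snd.fst)).sub
      (hmp.comp (measurable_fst.prodMk ((measurable_piecewise_update i).comp
        measurable_snd)))).pow_const 2).ennreal_ofReal
  have hmg : ∀ i : Fin d, Measurable fun p : ℝ × (Fin d → ℝ) =>
      ENNReal.ofReal (gradient h (point p.1 p.2) i.succ ^ 2) := fun i =>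
    (((measurable_gradient_apply h i.succ).comp measurable_point).pow_const 2).ennreal_ofReal
  rw [lintegral_lintegral_swap (Measurable.lintegral_prod_right' hm3).aemeasurable]
  calc _ ≤ ∫⁻ x : ℝ, 2 ^ d * ∑ i : Fin d, ∫⁻ p, ENNReal.ofReal
          ((h (point x p.1) - h (point x (Function.update p.1 i (p.2 i)))) ^ 2)
          ∂((cubeMeasure d).prod (cubeMeasure d)) :=
        lintegral_mono fun x => AllenCahn.lintegral_sub_sq_le (hmx x)
    _ = 2 ^ d * ∑ i : Fin d, ∫⁻ x : ℝ, ∫⁻ p, ENNReal.ofReal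
          ((h (point x p.1) - h (point x (Function.update p.1 i (p.2 i)))) ^ 2)
          ∂((cubeMeasure d).prod (cubeMeasure d)) := by
        rw [lintegral_const_mul' _ _ (by simp), lintegral_finsetSum]
        exact fun i _ => (hmi i).lintegral_prod_right'
    _ ≤ _ := by
        gcongr with i
        rw [lintegral_prod _ (hmg i).aemeasurable]
        refine lintegral_mono_ae ?_
        filter_upwards [Measure.ae_ae_of_ae_prod (hh.ae_sub_update_sq_le i)] with x hx
        have hmgx : Measurable fun y : Fin d → ℝ =>
            ENNReal.ofReal (gradient h (point x y) i.succ ^ 2) :=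
          (((measurable_gradient_apply h i.succ).comp
            (measurable_point.comp measurable_prodMk_left)).pow_const 2).ennreal_ofReal
        have hmix : Measurable fun q : (Fin d → ℝ) × (Fin d → ℝ) =>
            ENNReal.ofReal ((h (point x q.1) -
              h (point x (Function.update q.1 i (q.2 i)))) ^ 2) :=
          ((((hmx x).comp measurable_fst).sub
            ((hmx x).comp (measurable_piecewise_update i))).pow_const 2).ennreal_ofReal
        rw [lintegral_prod _ hmix.aemeasurable,
          ← lintegral_update i hmgx,
          lintegral_prod (fun p : (Fin d → ℝ) × (Fin d → ℝ) => ENNReal.ofReal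
            (gradient h (point x (Function.update p.1 i (p.2 i))) i.succ ^ 2))
            (hmgx.comp (measurable_piecewise_update i)).aemeasurable]
        refine lintegral_mono_ae ?_
        filter_upwards [hx] with y hy
        have hev : ∫⁻ y' : Fin d → ℝ, ENNReal.ofReal
            (gradient h (point x (Function.update y i (y' i))) i.succ ^ 2) ∂(cubeMeasure d) =
            ∫⁻ τ in Ioo 0 1,
              ENNReal.ofReal (gradient h (point x (Function.update y i τ)) i.succ ^ 2) :=
          (measurePreserving_eval (fun _ : Fin d => (volume : Measure ℝ).restrict (Ioo 0 1))
            i).lintegral_comp (hmgx.comp (measurable_update y))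
        rw [hev]
        refine (lintegral_mono_ae (g := fun _ => ∫⁻ τ in Ioo 0 1,
          ENNReal.ofReal (gradient h (point x (Function.update y i τ)) i.succ ^ 2)) ?_).trans_eq
            (by simp)
        filter_upwards [ae_mem_cube] with y' hy'
        exact hy (y' i) (hy' i (mem_univ i))

/-- The energy of the slice `x ↦ h (x, y)`, written with the gradient of `h`. -/
noncomputable def sliceEnergy (F : ℝ → ℝ) (h : Space d → ℝ) (y : Fin d → ℝ) : ℝ≥0∞ :=
  ∫⁻ x, ENNReal.ofReal (gradient h (point x y) 0 ^ 2 / 2 + F (h (point x y)))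

/-- Almost every slice of finite energy is a transition. -/
theorem PiecewiseDifferentiable.ae_isTransition (hF : IsDoubleWell F) {h : Space d → ℝ}
    (hh : PiecewiseDifferentiable h) (hb : HasBoundaryValues h) :
    ∀ᵐ y ∂(cubeMeasure d), sliceEnergy F h y ≠ ∞ →
      IsTransition F (fun x => h (point x y)) ∧ sliceEnergy F h y =
        ENNReal.ofReal (surfaceTension F + lineExcess F fun x => h (point x y)) := by
  obtain ⟨hc, S, hSD, hSo, hSf, hd⟩ := hh
  have hcount : ∀ᵐ y ∂(cubeMeasure d), {t | insertCoord 0 t y ∈ S}.Countable := by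
    rw [cubeMeasure_eq]
    exact ae_restrict_of_ae (ae_countable_slice 0 hSD hSo hSf)
  rw [HasBoundaryValues, ← cubeMeasure_eq] at hb
  filter_upwards [hcount, hb, ae_mem_cube] with y hy hby hyc hfin
  simp only [insertCoord_zero] at hy
  have hcont : Continuous fun x => h (point x y) := by
    refine hc.comp_continuous ?_ fun x => point_mem_domain.2 hyc
    simpa only [insertCoord_zero] using continuous_insertCoord 0 y
  have hderiv : ∀ x ∉ {t | point t y ∈ S},
      HasDerivAt (fun x => h (point x y)) (gradient h (point x y) 0) x := by
    intro x hx
    have := hasDerivAt_comp_insertCoord (j := 0) (t := x) (w := y) (h := h)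
      (by rw [insertCoord_zero]; exact hd _ ⟨point_mem_domain.2 hyc, hx⟩)
    simpa only [insertCoord_zero] using this
  have hae : (fun x => ENNReal.ofReal (gradient h (point x y) 0 ^ 2 / 2 + F (h (point x y)))) =ᵐ[
      volume] fun x => ENNReal.ofReal
        (deriv (fun x => h (point x y)) x ^ 2 / 2 + F (h (point x y))) := by
    filter_upwards [hy.ae_notMem volume] with x hx
    rw [(hderiv x hx).deriv]
  have hnn : ∀ x, 0 ≤ deriv (fun x => h (point x y)) x ^ 2 / 2 + F (h (point x y)) := fun x =>
    add_nonneg (by positivity) (hF.nonneg _)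
  have hmeas : Measurable fun x =>
      deriv (fun x => h (point x y)) x ^ 2 / 2 + F (h (point x y)) :=
    (((measurable_deriv _).pow_const 2).div_const 2).add
      (hF.continuous.measurable.comp hcont.measurable)
  rw [sliceEnergy, lintegral_congr_ae hae] at hfin ⊢
  have hint := (lintegral_ofReal_ne_top_iff_integrable hmeas.aestronglyMeasurable
    (Eventually.of_forall hnn)).1 hfin
  refine ⟨⟨hcont, ⟨_, hy, fun x hx => (hderiv x hx).differentiableAt⟩, hby.1, hby.2, hint⟩, ?_⟩
  rw [← ofReal_integral_eq_lintegral_ofReal hint (Eventually.of_forall hnn), lineExcess]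
  ring_nf

/-- The energy splits into the energies of the slices and the integrals of the squared
derivatives in the directions of the cube. -/
theorem lintegral_energy_eq (hF : IsDoubleWell F) {h : Space d → ℝ} (hm : Measurable h) :
    ∫⁻ z, ENNReal.ofReal (‖gradient h z‖ ^ 2 / 2 + F (h z)) ∂(domainMeasure d) =
      ∫⁻ y, sliceEnergy F h y ∂(cubeMeasure d) + 2⁻¹ * ∑ i : Fin d, ∫⁻ p,
        ENNReal.ofReal (gradient h (point p.1 p.2) i.succ ^ 2)
          ∂((volume : Measure ℝ).prod (cubeMeasure d)) := by
  have hm0 : Measurable fun p : ℝ × (Fin d → ℝ) =>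
      ENNReal.ofReal (gradient h (point p.1 p.2) 0 ^ 2 / 2 + F (h (point p.1 p.2))) :=
    (((((measurable_gradient_apply h 0).comp measurable_point).pow_const 2).div_const 2).add
      (hF.continuous.measurable.comp (hm.comp measurable_point))).ennreal_ofReal
  have hmg : ∀ i : Fin d, Measurable fun p : ℝ × (Fin d → ℝ) =>
      ENNReal.ofReal (gradient h (point p.1 p.2) i.succ ^ 2) := fun i =>
    (((measurable_gradient_apply h i.succ).comp measurable_point).pow_const 2).ennreal_ofReal
  have hsplit : ∀ z : Space d, ENNReal.ofReal (‖gradient h z‖ ^ 2 / 2 + F (h z)) =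
      ENNReal.ofReal (gradient h z 0 ^ 2 / 2 + F (h z)) +
        2⁻¹ * ∑ i : Fin d, ENNReal.ofReal (gradient h z i.succ ^ 2) := by
    intro z
    have h2 : (2⁻¹ : ℝ≥0∞) = ENNReal.ofReal 2⁻¹ := by
      rw [ENNReal.ofReal_inv_of_pos two_pos, ENNReal.ofReal_ofNat]
    rw [← ENNReal.ofReal_sum_of_nonneg fun i _ => sq_nonneg _, h2,
      ← ENNReal.ofReal_mul (by positivity),
      ← ENNReal.ofReal_add (add_nonneg (by positivity) (hF.nonneg _))
        (mul_nonneg (by positivity) (Finset.sum_nonneg fun i _ => sq_nonneg _)), norm_sq_eq_sum]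
    ring_nf
  simp only [hsplit]
  rw [lintegral_domainMeasure, lintegral_add_left hm0, lintegral_prod_symm' _ hm0,
    lintegral_const_mul' _ _ (by simp), lintegral_finsetSum _ fun i _ => hmg i]
  rfl

theorem surfaceTension_nonneg (F : ℝ → ℝ) : 0 ≤ surfaceTension F :=
  intervalIntegral.integral_nonneg (by norm_num) fun _ _ => Real.sqrt_nonneg _

theorem freeEnergy_le_iff {h : Space d → ℝ} {Dh : Space d → Space d} {c : ℝ}
    (hc : 0 ≤ surfaceTension F + c) : freeEnergy F h Dh ≤ (c : EReal) ↔
      ∫⁻ z, ENNReal.ofReal (‖Dh z‖ ^ 2 / 2 + F (h z)) ∂(domainMeasure d) ≤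
        ENNReal.ofReal (surfaceTension F + c) := by
  rw [freeEnergy, EReal.sub_le_iff_le_add (by simp) (by simp), ← EReal.coe_add, add_comm c,
    ← EReal.coe_ennreal_le_coe_ennreal_iff, EReal.coe_ennreal_ofReal, max_eq_left hc]

/-- The distance of `h` to a translate of the profile, by comparison with a single slice. -/
theorem lintegral_sub_wave_sq_le (hcm : Continuous (profile F)) {h : Space d → ℝ}
    (hm : Measurable h) (y' : Fin d → ℝ) (ξ : ℝ) :
    ∫⁻ z, ENNReal.ofReal ((h z - wave F d ξ z) ^ 2) ∂(domainMeasure d) ≤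
      2 * (∫⁻ x : ℝ, ∫⁻ y, ENNReal.ofReal ((h (point x y) - h (point x y')) ^ 2)
        ∂(cubeMeasure d)) +
      2 * ∫⁻ x, ENNReal.ofReal ((h (point x y') - profile F (x - ξ)) ^ 2) := by
  have hmp : Measurable fun p : ℝ × (Fin d → ℝ) => h (point p.1 p.2) := hm.comp measurable_point
  have hmw : Measurable fun p : ℝ × (Fin d → ℝ) =>
      ENNReal.ofReal ((h (point p.1 p.2) - profile F (p.1 - ξ)) ^ 2) :=
    ((hmp.sub (hcm.measurable.comp (measurable_fst.sub_const ξ))).pow_const 2).ennreal_ofReal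
  have hmx : ∀ x, Measurable fun y : Fin d → ℝ =>
      ENNReal.ofReal ((h (point x y) - h (point x y')) ^ 2) := fun x =>
    (((hmp.comp measurable_prodMk_left).sub_const _).pow_const 2).ennreal_ofReal
  have hm1 : Measurable fun x : ℝ => ENNReal.ofReal ((h (point x y') - profile F (x - ξ)) ^ 2) :=
    (((hmp.comp (measurable_id.prodMk measurable_const)).sub
      (hcm.measurable.comp (measurable_id.sub_const ξ))).pow_const 2).ennreal_ofReal
  rw [lintegral_domainMeasure]
  simp only [wave, point_zero]
  rw [lintegral_prod _ hmw.aemeasurable, ← lintegral_const_mul' _ _ (by simp),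
    ← lintegral_const_mul' _ _ (by simp), ← lintegral_add_right _ (hm1.const_mul 2)]
  refine lintegral_mono fun x => ?_
  calc _ ≤ ∫⁻ y, (2 * ENNReal.ofReal ((h (point x y) - h (point x y')) ^ 2) +
        2 * ENNReal.ofReal ((h (point x y') - profile F (x - ξ)) ^ 2)) ∂(cubeMeasure d) :=
        lintegral_mono fun y => ofReal_sub_sq_le _ _ _
    _ = _ := by
        rw [lintegral_add_left ((hmx x).const_mul 2), lintegral_const_mul' _ _ (by simp)]
        simp

/-- A piecewise differentiable function of small excess energy is close to the profiles: a slice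
with controlled energy, close on average to the other slices, is close to a profile. -/
theorem exists_distL2_le (hF : IsDoubleWell F) (d : ℕ) : ∃ c : ℝ, 0 < c ∧ ∀ δ : ℝ, 0 ≤ δ → δ ≤ 1 →
    ∀ h : Space d → ℝ, Measurable h → PiecewiseDifferentiable h → HasBoundaryValues h →
      freeEnergy F h (gradient h) ≤ ((c * δ ^ 2 : ℝ) : EReal) →
        distL2 F h ≤ ENNReal.ofReal δ := by
  have hprof := hF.isProfile_profile
  obtain ⟨ε, C, hε, hC, hstab⟩ := IsTransition.exists_lintegral_sub_sq_le hF hprof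
  refine ⟨min ε (1 / (2 * (2 ^ (d + 1) + C))), lt_min hε (by positivity), ?_⟩
  set c := min ε (1 / (2 * (2 ^ (d + 1) + C)))
  have hc0 : 0 < c := lt_min hε (by positivity)
  have hcC : 2 * (2 ^ (d + 1) + C) * c ≤ 1 := by
    have : c ≤ 1 / (2 * (2 ^ (d + 1) + C)) := min_le_right _ _
    rwa [le_div_iff₀ (by positivity), mul_comm] at this
  intro δ hδ0 hδ1 h hm hh hb hE
  have hcδ : 0 ≤ c * δ ^ 2 := by positivity
  rw [freeEnergy_le_iff (add_nonneg (surfaceTension_nonneg F) hcδ),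
    lintegral_energy_eq hF hm] at hE
  set P : (Fin d → ℝ) → ℝ≥0∞ := fun y' =>
    ∫⁻ x : ℝ, ∫⁻ y, ENNReal.ofReal ((h (point x y) - h (point x y')) ^ 2) ∂(cubeMeasure d)
    with hP
  have hPoinc := hh.lintegral_sub_sq_le hm
  have hmp : Measurable fun p : ℝ × (Fin d → ℝ) => h (point p.1 p.2) := hm.comp measurable_point
  have hmP : Measurable P := by
    have hm3 : Measurable fun q : ((Fin d → ℝ) × ℝ) × (Fin d → ℝ) =>
        ENNReal.ofReal ((h (point q.1.2 q.2) - h (point q.1.2 q.1.1)) ^ 2) :=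
      (((hmp.comp (measurable_fst.snd.prodMk measurable_snd)).sub
        (hmp.comp (measurable_fst.snd.prodMk measurable_fst.fst))).pow_const 2).ennreal_ofReal
    exact (Measurable.lintegral_prod_right' hm3).lintegral_prod_right'
  have hmS : Measurable (sliceEnergy F h) := by
    refine Measurable.lintegral_prod_left' (f := fun p : ℝ × (Fin d → ℝ) =>
      ENNReal.ofReal (gradient h (point p.1 p.2) 0 ^ 2 / 2 + F (h (point p.1 p.2)))) ?_
    exact (((((measurable_gradient_apply h 0).comp measurable_point).pow_const 2).div_const 2).add
      (hF.continuous.measurable.comp hmp)).ennreal_ofReal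
  -- with this weight, the distances between slices are paid for by the derivatives along the cube
  set κ : ℝ≥0∞ := (2 ^ (d + 1))⁻¹ with hκ
  have hκ' : κ * 2 ^ d = 2⁻¹ := by
    rw [hκ, pow_succ, ENNReal.mul_inv (by simp) (by simp), mul_comm, ← mul_assoc,
      ENNReal.mul_inv_cancel (by simp) (by simp), one_mul]
  have hκtop : κ ≠ ∞ := by simp [hκ]
  have hmean : ∫⁻ y', (sliceEnergy F h y' + κ * P y') ∂(cubeMeasure d) ≤
      ENNReal.ofReal (surfaceTension F + c * δ ^ 2) := by
    refine le_trans ?_ hE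
    rw [lintegral_add_right _ (hmP.const_mul κ), lintegral_const_mul' _ _ hκtop, ← hκ', mul_assoc]
    gcongr
  -- a slice at which the energy and the distance to the others do not exceed their means
  obtain ⟨y', hy', hle⟩ := exists_notMem_null_le_lintegral
    (hmS.add (hmP.const_mul κ)).aemeasurable (hh.ae_isTransition hF hb)
  rw [mem_compl_iff, not_not] at hy'
  replace hle : sliceEnergy F h y' + κ * P y' ≤ _ := hle.trans hmean
  obtain ⟨htr, hes⟩ := hy' (ne_top_of_le_ne_top ENNReal.ofReal_ne_top (le_self_add.trans hle))
  set L := lineExcess F fun x => h (point x y')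
  have hL0 : 0 ≤ L := htr.lineExcess_nonneg hF
  rw [hes, ENNReal.ofReal_add (surfaceTension_nonneg F) hL0,
    ENNReal.ofReal_add (surfaceTension_nonneg F) hcδ, add_assoc,
    ENNReal.add_le_add_iff_left ENNReal.ofReal_ne_top] at hle
  have hL : L ≤ c * δ ^ 2 := (ENNReal.ofReal_le_ofReal_iff hcδ).1 (le_self_add.trans hle)
  have hPle : P y' ≤ ENNReal.ofReal (2 ^ (d + 1) * (c * δ ^ 2)) := by
    rw [ENNReal.ofReal_mul (by positivity), ENNReal.ofReal_pow zero_le_two, ENNReal.ofReal_ofNat]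
    calc P y' = 2 ^ (d + 1) * (κ * P y') := by
          rw [← mul_assoc, hκ, ENNReal.mul_inv_cancel (by simp) (by simp), one_mul]
      _ ≤ _ := by gcongr; exact le_add_self.trans hle
  have hδsq : δ ^ 2 ≤ 1 := pow_le_one₀ hδ0 hδ1
  obtain ⟨ξ, hξ⟩ := hstab _ htr (hL.trans (by
    have := min_le_left ε (1 / (2 * (2 ^ (d + 1) + C)))
    nlinarith))
  refine (iInf_le _ ξ).trans ?_
  have hdist : ∫⁻ z, ‖h z - wave F d ξ z‖ₑ ^ (2 : ℝ) ∂(domainMeasure d) ≤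
      ENNReal.ofReal (δ ^ 2) := by
    have hpt : ∀ z, ‖h z - wave F d ξ z‖ₑ ^ (2 : ℝ) =
        ENNReal.ofReal ((h z - wave F d ξ z) ^ 2) := fun z => by
      rw [← ofReal_norm, ENNReal.ofReal_rpow_of_nonneg (norm_nonneg _) zero_le_two,
        Real.rpow_two, Real.norm_eq_abs, sq_abs]
    simp only [hpt]
    calc _ ≤ 2 * P y' +
          2 * ∫⁻ x, ENNReal.ofReal ((h (point x y') - profile F (x - ξ)) ^ 2) :=
          lintegral_sub_wave_sq_le hprof.continuous hm y' ξ
      _ ≤ 2 * ENNReal.ofReal (2 ^ (d + 1) * (c * δ ^ 2)) + 2 * ENNReal.ofReal (C * L) := by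
          gcongr
      _ = ENNReal.ofReal (2 * (2 ^ (d + 1) * (c * δ ^ 2)) + 2 * (C * L)) := by
          rw [ENNReal.ofReal_add (by positivity) (by positivity),
            ENNReal.ofReal_mul zero_le_two, ENNReal.ofReal_mul zero_le_two, ENNReal.ofReal_ofNat]
      _ ≤ ENNReal.ofReal (δ ^ 2) := by
          refine ENNReal.ofReal_le_ofReal ?_
          have h1 : C * L ≤ C * (c * δ ^ 2) := mul_le_mul_of_nonneg_left hL hC.le
          have h2 := mul_le_mul_of_nonneg_right hcC (sq_nonneg δ)
          linarith
  rw [eLpNorm_eq_lintegral_rpow_enorm_toReal two_ne_zero ENNReal.ofNat_ne_top,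
    ENNReal.toReal_ofNat]
  calc _ ≤ ENNReal.ofReal (δ ^ 2) ^ (1 / (2 : ℝ)) := by gcongr
    _ = ENNReal.ofReal δ := by
      rw [ENNReal.ofReal_rpow_of_nonneg (by positivity) (by norm_num), ← Real.sqrt_eq_rpow,
        Real.sqrt_sq hδ0]

/-- The measurability assumption is removed by setting the function to zero off the cylinder, where
neither side sees it. -/
theorem exists_lt_freeEnergy (hF : IsDoubleWell F) (d : ℕ) :
    ∃ c₀ δ₀ : ℝ, 0 < c₀ ∧ 0 < δ₀ ∧ ∀ δ : ℝ, 0 ≤ δ → δ ≤ δ₀ → ∀ h : Space d → ℝ,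
      PiecewiseDifferentiable h → HasBoundaryValues h → ENNReal.ofReal δ < distL2 F h →
        ((c₀ * δ ^ 2 : ℝ) : EReal) < freeEnergy F h (gradient h) := by
  obtain ⟨c, hc, H⟩ := exists_distL2_le hF d
  refine ⟨c, 1, hc, one_pos, fun δ hδ0 hδ1 h hh hb hδ => ?_⟩
  by_contra! hE
  refine hδ.not_ge ?_
  set g := (domain d).indicator h
  have hgh : EqOn g h (domain d) := fun z hz => indicator_of_mem hz h
  have hev : ∀ z ∈ domain d, g =ᶠ[𝓝 z] h := fun z hz =>
    hgh.eventuallyEq_of_mem ((isOpen_domain d).mem_nhds hz)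
  have hgrad : ∀ z ∈ domain d, gradient g z = gradient h z := fun z hz => by
    rw [gradient, gradient, (hev z hz).fderiv_eq]
  have hgm : Measurable g := by
    classical
    rw [show g = (domain d).piecewise h 0 from (piecewise_eq_indicator ..).symm]
    exact hh.1.measurable_piecewise continuous_zero.continuousOn (measurableSet_domain d)
  have hgp : PiecewiseDifferentiable g := by
    obtain ⟨hcont, S, hSD, hSo, hSf, hd⟩ := hh
    exact ⟨hcont.congr hgh, S, hSD, hSo, hSf, fun z hz =>
      (hd z hz).congr_of_eventuallyEq (hev z hz.1)⟩
  have hgb : HasBoundaryValues g := by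
    filter_upwards [hb, ae_restrict_mem (measurableSet_cube d)] with y hy hyc
    simpa only [hgh (point_mem_domain.2 hyc)] using hy
  have hdist : distL2 F g = distL2 F h := by
    unfold distL2
    congr 1
    ext ξ
    refine eLpNorm_congr_ae ?_
    filter_upwards [ae_restrict_mem (measurableSet_domain d)] with z hz
    rw [hgh hz]
  have hfree : freeEnergy F g (gradient g) = freeEnergy F h (gradient h) := by
    unfold freeEnergy
    congr 2
    refine lintegral_congr_ae ?_
    filter_upwards [ae_restrict_mem (measurableSet_domain d)] with z hz
    rw [hgrad z hz, hgh hz]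
  rw [← hdist]
  exact H δ hδ0 hδ1 g hgm hgp hgb (hfree.trans_le hE)

/-! ### Integration by parts against functions of the axial coordinate -/

/-- The axial coordinate preserves measure, since the cross-section has measure one. -/
theorem measurePreserving_axial (d : ℕ) :
    MeasurePreserving (fun z : Space d => z 0) (domainMeasure d) volume := by
  have h := (measurePreserving_fst (μ := (volume : Measure ℝ)) (ν := cubeMeasure d)).comp
    (measurePreserving_pointEquiv d).symm
  have he : (fun z : Space d => z 0) = Prod.fst ∘ (pointEquiv d).symm := by
    ext z
    obtain ⟨p, rfl⟩ := (pointEquiv d).surjective z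
    rw [Function.comp_apply, MeasurableEquiv.symm_apply_apply, pointEquiv_apply, point_zero]
  rw [he]
  exact h

instance : IsFiniteMeasureOnCompacts (domainMeasure d) := by
  unfold domainMeasure; infer_instance

/-- The axial integration by parts formula `∫ v q = -∫ p ∂ₓv`, for a function `p` of the axial
coordinate with derivative `q` and a function `v` on the cylinder with gradient `Dv`. -/
def IsAxialByParts (v : Space d → ℝ) (Dv : Space d → Space d) (p q : ℝ → ℝ) : Prop :=
  ∫ z, v z * q (z 0) ∂(domainMeasure d) = -∫ z, p (z 0) * Dv z 0 ∂(domainMeasure d)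

theorem memLp_comp_axial {p : ℝ → ℝ} (hp : MemLp p 2) :
    MemLp (fun z : Space d => p (z 0)) 2 (domainMeasure d) :=
  hp.comp_measurePreserving (measurePreserving_axial d)

theorem memLp_apply {g : Space d → Space d} {μ : Measure (Space d)} (hg : MemLp g 2 μ)
    (j : Fin (d + 1)) : MemLp (fun z => g z j) 2 μ :=
  (EuclideanSpace.proj (𝕜 := ℝ) j).comp_memLp' hg

/-- Axial integration by parts passes to pointwise limits dominated in `L²(ℝ)`. -/
theorem IsAxialByParts.of_tendsto {v : Space d → ℝ} {Dv : Space d → Space d} (hv : IsH1 v Dv)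
    {p q : ℕ → ℝ → ℝ} {p' q' G : ℝ → ℝ} (hG : MemLp G 2)
    (hp : ∀ n, Continuous (p n)) (hq : ∀ n, Continuous (q n))
    (hpG : ∀ n x, |p n x| ≤ G x) (hqG : ∀ n x, |q n x| ≤ G x)
    (hpt : ∀ x, Tendsto (fun n => p n x) atTop (𝓝 (p' x)))
    (hqt : ∀ x, Tendsto (fun n => q n x) atTop (𝓝 (q' x)))
    (h : ∀ n, IsAxialByParts v Dv (p n) (q n)) : IsAxialByParts v Dv p' q' := by
  have hx : Continuous fun z : Space d => z 0 := by fun_prop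
  have hw := memLp_apply hv.memLp_grad 0
  have h1 : Tendsto (fun n => ∫ z, v z * q n (z 0) ∂(domainMeasure d)) atTop
      (𝓝 (∫ z, v z * q' (z 0) ∂(domainMeasure d))) := by
    refine tendsto_integral_of_dominated_convergence (fun z => |v z| * G (z 0))
      (fun n => hv.memLp.aestronglyMeasurable.mul ((hq n).comp hx).aestronglyMeasurable)
      (hv.memLp.norm.integrable_mul (memLp_comp_axial hG))
      (fun n => Eventually.of_forall fun z => ?_)
      (Eventually.of_forall fun z => (hqt _).const_mul _)
    rw [Real.norm_eq_abs, abs_mul]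
    exact mul_le_mul_of_nonneg_left (hqG _ _) (abs_nonneg _)
  have h2 : Tendsto (fun n => ∫ z, p n (z 0) * Dv z 0 ∂(domainMeasure d)) atTop
      (𝓝 (∫ z, p' (z 0) * Dv z 0 ∂(domainMeasure d))) := by
    refine tendsto_integral_of_dominated_convergence (fun z => G (z 0) * |Dv z 0|)
      (fun n => ((hp n).comp hx).aestronglyMeasurable.mul hw.aestronglyMeasurable)
      ((memLp_comp_axial hG).integrable_mul hw.norm)
      (fun n => Eventually.of_forall fun z => ?_)
      (Eventually.of_forall fun z => (hpt _).mul_const _)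
    rw [Real.norm_eq_abs, abs_mul]
    exact mul_le_mul_of_nonneg_right (hpG _ _) (abs_nonneg _)
  exact tendsto_nhds_unique h1 (h2.neg.congr fun n => (h n).symm)

/-- Bump functions increasing to the indicator function of `(0, 1)`. -/
noncomputable def unitBump (n : ℕ) : ContDiffBump (1 / 2 : ℝ) where
  rIn := 1 / 2 - 1 / (n + 3)
  rOut := 1 / 2 - 1 / (n + 4)
  rIn_pos := by
    have : (1 : ℝ) / (n + 3) < 1 / 2 := by
      rw [div_lt_div_iff₀ (by positivity) two_pos]; linarith [n.cast_nonneg (α := ℝ)]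
    linarith
  rIn_lt_rOut := by
    have : (1 : ℝ) / (n + 4) < 1 / (n + 3) :=
      one_div_lt_one_div_of_lt (by positivity) (by linarith)
    linarith

theorem tsupport_unitBump_subset (n : ℕ) : tsupport (unitBump n) ⊆ Ioo 0 1 := by
  rw [ContDiffBump.tsupport_eq, Real.closedBall_eq_Icc]
  have h : (0 : ℝ) < 1 / (n + 4) := by positivity
  intro x hx
  simp only [unitBump, mem_Icc] at hx
  constructor <;> linarith [hx.1, hx.2]

theorem eventually_unitBump_eq_one {x : ℝ} (hx : x ∈ Ioo (0 : ℝ) 1) :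
    ∀ᶠ n in atTop, unitBump n x = 1 := by
  have h : Tendsto (fun n : ℕ => (1 : ℝ) / 2 - 1 / (n + 3)) atTop (𝓝 (1 / 2 - 0)) := by
    refine tendsto_const_nhds.sub ?_
    have := (tendsto_one_div_add_atTop_nhds_zero_nat (𝕜 := ℝ)).comp (tendsto_add_atTop_nat 2)
    refine this.congr fun n => ?_
    simp only [Function.comp_apply]
    push_cast
    ring_nf
  have hlt : |x - 1 / 2| < 1 / 2 - 0 := by
    rw [abs_lt]; constructor <;> linarith [hx.1, hx.2]
  filter_upwards [h.eventually_const_lt hlt] with n hn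
  refine (unitBump n).one_of_mem_closedBall ?_
  rw [Metric.mem_closedBall, Real.dist_eq]
  exact hn.le

/-- Smooth functions of the cross-sectional coordinate cutting off near the boundary of the
cylinder. -/
noncomputable def crossBump (d n : ℕ) (z : Space d) : ℝ := ∏ i : Fin d, unitBump n (z i.succ)

theorem contDiff_crossBump (d n : ℕ) : ContDiff ℝ (⊤ : ℕ∞) (crossBump d n) :=
  contDiff_prod fun i _ => (unitBump n).contDiff.comp
    (EuclideanSpace.proj (𝕜 := ℝ) (i.succ : Fin (d + 1))).contDiff

theorem abs_crossBump_le (n : ℕ) (z : Space d) : |crossBump d n z| ≤ 1 := by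
  rw [crossBump, abs_of_nonneg (Finset.prod_nonneg fun i _ => (unitBump n).nonneg)]
  exact Finset.prod_le_one (fun i _ => (unitBump n).nonneg) fun i _ => (unitBump n).le_one

theorem tendsto_crossBump {z : Space d} (hz : z ∈ domain d) :
    Tendsto (fun n => crossBump d n z) atTop (𝓝 1) := by
  refine tendsto_const_nhds.congr' ?_
  have h : ∀ᶠ n in atTop, ∀ i : Fin d, unitBump n (z i.succ) = 1 :=
    eventually_all.2 fun i => eventually_unitBump_eq_one (hz i)
  filter_upwards [h] with n hn
  simp [crossBump, hn]

/-- The compact set of points with axial coordinate in `K` and cross-sectional coordinates in the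
support of `unitBump n`. -/
theorem isCompact_bumpBox {K : Set ℝ} (hK : IsCompact K) (n : ℕ) :
    IsCompact {z : Space d | z 0 ∈ K ∧ ∀ i : Fin d, z i.succ ∈ tsupport (unitBump n)} := by
  set s : Fin (d + 1) → Set ℝ :=
    Fin.cons (α := fun _ => Set ℝ) K fun _ => tsupport (unitBump n) with hs
  have h := isCompact_univ_pi (s := s)
    (Fin.cases (by simpa [hs] using hK) fun _ => by
      simpa only [hs, Fin.cons_succ] using (unitBump n).hasCompactSupport.isCompact)
  have h' := h.image (PiLp.continuous_toLp 2 fun _ : Fin (d + 1) => ℝ)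
  convert h' using 1
  ext z
  constructor
  · rintro ⟨h0, h1⟩
    refine ⟨WithLp.ofLp z, ?_, rfl⟩
    intro j _
    refine Fin.cases ?_ (fun i => ?_) j
    · simpa [hs] using h0
    · simpa only [hs, Fin.cons_succ] using h1 i
  · rintro ⟨w, hw, rfl⟩
    exact ⟨by simpa [hs] using hw 0 (mem_univ _), fun i => by
      simpa only [hs, Fin.cons_succ] using hw i.succ (mem_univ _)⟩

/-- A smooth function of the axial coordinate becomes a test function when it is multiplied by
`crossBump`, whose axial derivative vanishes. -/
theorem isAxialByParts_of_contDiff {v : Space d → ℝ} {Dv : Space d → Space d} (hv : IsH1 v Dv)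
    {f : ℝ → ℝ} (hf : ContDiff ℝ (⊤ : ℕ∞) f) (hfc : HasCompactSupport f) :
    IsAxialByParts v Dv f (deriv f) := by
  have hx : Continuous fun z : Space d => z 0 := by fun_prop
  have hw := memLp_apply hv.memLp_grad 0
  have hf' : Continuous (deriv f) := hf.continuous_deriv (by simp)
  have hfL : MemLp (fun z : Space d => f (z 0)) 2 (domainMeasure d) :=
    memLp_comp_axial (hf.continuous.memLp_of_hasCompactSupport hfc)
  have hfL' : MemLp (fun z : Space d => deriv f (z 0)) 2 (domainMeasure d) :=
    memLp_comp_axial (hf'.memLp_of_hasCompactSupport hfc.deriv)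
  have hmem : ∀ᵐ z ∂(domainMeasure d), z ∈ domain d := ae_restrict_mem (measurableSet_domain d)
  have key : ∀ n, ∫ z, v z * (deriv f (z 0) * crossBump d n z) ∂(domainMeasure d) =
      -∫ z, f (z 0) * crossBump d n z * Dv z 0 ∂(domainMeasure d) := by
    intro n
    set φ : Space d → ℝ := fun z => f (z 0) * crossBump d n z
    have hφ : ContDiff ℝ (⊤ : ℕ∞) φ :=
      (hf.comp (EuclideanSpace.proj (𝕜 := ℝ) (0 : Fin (d + 1))).contDiff).mul
        (contDiff_crossBump d n)
    have hsub : Function.support φ ⊆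
        {z : Space d | z 0 ∈ tsupport f ∧ ∀ i : Fin d, z i.succ ∈ tsupport (unitBump n)} := by
      intro z hz
      have hz' := mul_ne_zero_iff.1 hz
      exact ⟨subset_tsupport _ hz'.1, fun i => subset_tsupport _
        (Finset.prod_ne_zero_iff.1 hz'.2 i (Finset.mem_univ i))⟩
    have hbox := isCompact_bumpBox (d := d) hfc.isCompact n
    have hφc : HasCompactSupport φ := .of_support_subset_isCompact hbox hsub
    have hφD : tsupport φ ⊆ domain d := fun z hz i =>
      tsupport_unitBump_subset n ((closure_minimal hsub hbox.isClosed hz).2 i)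
    have hgrad : ∀ z, gradient φ z 0 = deriv f (z 0) * crossBump d n z := by
      intro z
      have hz : z = insertCoord 0 (z 0) (forget 0 z) := by
        ext j
        refine Fin.cases ?_ (fun i => ?_) j
        · simp
        · exact (congrFun (forget_insertCoord 0 (z 0) (forget 0 z)) i).symm
      have h1 := hasDerivAt_comp_insertCoord (h := φ) (j := 0) (t := z 0) (w := forget 0 z)
        (hφ.differentiable (by simp) _)
      rw [← hz] at h1
      have h2 : HasDerivAt (fun t => φ (insertCoord 0 t (forget 0 z)))
          (deriv f (z 0) * crossBump d n z) (z 0) := by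
        have hcb : ∀ t, crossBump d n (insertCoord 0 t (forget 0 z)) = crossBump d n z := by
          intro t
          refine Finset.prod_congr rfl fun i _ => ?_
          exact congrArg _ (congrFun (forget_insertCoord 0 t (forget 0 z)) i)
        simp only [φ, insertCoord_apply_self, hcb]
        exact ((hf.differentiable (by simp) _).hasDerivAt).mul_const _
      exact h1.unique h2
    have hcg : Continuous (gradient φ) :=
      (InnerProductSpace.toDual ℝ (Space d)).symm.continuous.comp
        (hφ.continuous_fderiv (by simp))
    have hcgc : HasCompactSupport (gradient φ) :=
      (hφc.fderiv (𝕜 := ℝ)).comp_left (map_zero _)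
    have hi1 : Integrable (fun z => v z • gradient φ z) (domainMeasure d) :=
      memLp_one_iff_integrable.1
        (MemLp.smul (hcg.memLp_of_hasCompactSupport (p := 2) hcgc) hv.memLp)
    have hi2 : Integrable (fun z => φ z • Dv z) (domainMeasure d) :=
      memLp_one_iff_integrable.1
        (MemLp.smul hv.memLp_grad (hφ.continuous.memLp_of_hasCompactSupport (p := 2) hφc))
    have h := congrArg (EuclideanSpace.proj (𝕜 := ℝ) (0 : Fin (d + 1)))
      (hv.isWeakGradient.integral_eq φ hφ hφc hφD)
    rw [map_neg, ← ContinuousLinearMap.integral_comp_comm _ hi1,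
      ← ContinuousLinearMap.integral_comp_comm _ hi2] at h
    simpa [hgrad] using h
  have hcb : ∀ n, AEStronglyMeasurable (crossBump d n) (domainMeasure d) := fun n =>
    (contDiff_crossBump d n).continuous.aestronglyMeasurable
  have h1 : Tendsto (fun n => ∫ z, v z * (deriv f (z 0) * crossBump d n z) ∂(domainMeasure d))
      atTop (𝓝 (∫ z, v z * deriv f (z 0) ∂(domainMeasure d))) := by
    refine tendsto_integral_of_dominated_convergence (fun z => |v z| * |deriv f (z 0)|)
      (fun n => hv.memLp.aestronglyMeasurable.mul (hfL'.aestronglyMeasurable.mul (hcb n)))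
      (hv.memLp.norm.integrable_mul hfL'.norm)
      (fun n => Eventually.of_forall fun z => ?_) ?_
    · rw [Real.norm_eq_abs, abs_mul, abs_mul]
      exact mul_le_mul_of_nonneg_left
        (mul_le_of_le_one_right (abs_nonneg _) (abs_crossBump_le n z)) (abs_nonneg _)
    · filter_upwards [hmem] with z hz
      simpa using ((tendsto_crossBump hz).const_mul (deriv f (z 0))).const_mul (v z)
  have h2 : Tendsto (fun n => ∫ z, f (z 0) * crossBump d n z * Dv z 0 ∂(domainMeasure d))
      atTop (𝓝 (∫ z, f (z 0) * Dv z 0 ∂(domainMeasure d))) := by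
    refine tendsto_integral_of_dominated_convergence (fun z => |f (z 0)| * |Dv z 0|)
      (fun n => (hfL.aestronglyMeasurable.mul (hcb n)).mul hw.aestronglyMeasurable)
      (hfL.norm.integrable_mul hw.norm)
      (fun n => Eventually.of_forall fun z => ?_) ?_
    · rw [Real.norm_eq_abs, abs_mul, abs_mul]
      exact mul_le_mul_of_nonneg_right
        (mul_le_of_le_one_right (abs_nonneg _) (abs_crossBump_le n z)) (abs_nonneg _)
    · filter_upwards [hmem] with z hz
      simpa using ((tendsto_crossBump hz).const_mul (f (z 0))).mul_const (Dv z 0)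
  exact tendsto_nhds_unique h1 (h2.neg.congr fun n => (key n).symm)

/-- Bump functions shrinking to the origin. -/
noncomputable def originBump (n : ℕ) : ContDiffBump (0 : ℝ) where
  rIn := 1 / 2 / (n + 1)
  rOut := 1 / (n + 1)
  rIn_pos := by positivity
  rIn_lt_rOut := by gcongr; norm_num

theorem originBump_rOut_le (n : ℕ) : (originBump n).rOut ≤ 1 := by
  rw [show (originBump n).rOut = 1 / ((n : ℝ) + 1) from rfl, div_le_one (by positivity)]
  linarith [n.cast_nonneg (α := ℝ)]

theorem tendsto_originBump_rOut : Tendsto (fun n => (originBump n).rOut) atTop (𝓝 0) :=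
  tendsto_one_div_add_atTop_nhds_zero_nat

/-- Mollifications of a function bounded by `C` and supported in `[-R, R]` are dominated by a
fixed multiple of the indicator function of `[-R - 1, R + 1]`. -/
theorem abs_convolution_originBump_le {k : ℝ → ℝ} (hk : Continuous k) {C R : ℝ}
    (hC : ∀ x, |k x| ≤ C) (hR : ∀ x, R < |x| → k x = 0) (n : ℕ) (x : ℝ) :
    |convolution ((originBump n).normed volume) k (ContinuousLinearMap.lsmul ℝ ℝ) volume x| ≤
      (Icc (-(R + 1)) (R + 1)).indicator (fun _ => 3 * C) x := by
  by_cases hx : x ∈ Icc (-(R + 1)) (R + 1)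
  · rw [indicator_of_mem hx]
    have h := ContDiffBump.dist_normed_convolution_le (φ := originBump n) (μ := volume) (x₀ := x)
      (ε := 2 * C) hk.aestronglyMeasurable fun y _ => by
        rw [Real.dist_eq]
        linarith [abs_sub (k y) (k x), hC x, hC y]
    rw [Real.dist_eq] at h
    have := abs_sub_abs_le_abs_sub
      (convolution ((originBump n).normed volume) k (ContinuousLinearMap.lsmul ℝ ℝ) volume x) (k x)
    linarith [hC x]
  · rw [indicator_of_notMem hx]
    have hxR : R + 1 < |x| := by
      rw [mem_Icc, ← abs_le, not_le] at hx
      exact hx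
    have hkx : k x = 0 := hR x (by linarith)
    have h := ContDiffBump.dist_normed_convolution_le (φ := originBump n) (μ := volume) (x₀ := x)
      (ε := 0) hk.aestronglyMeasurable fun y hy => by
        rw [Metric.mem_ball, Real.dist_eq] at hy
        have hy1 := hy.trans_le (originBump_rOut_le n)
        have := abs_sub_abs_le_abs_sub x y
        rw [abs_sub_comm] at this
        rw [hkx, hR y (by linarith), dist_self]
    rwa [hkx, Real.dist_eq, sub_zero] at h

/-- By mollification, the test functions need only be continuously differentiable. -/
theorem isAxialByParts_of_contDiff_one {v : Space d → ℝ} {Dv : Space d → Space d}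
    (hv : IsH1 v Dv) {k : ℝ → ℝ} (hk : ContDiff ℝ 1 k) (hkc : HasCompactSupport k) :
    IsAxialByParts v Dv k (deriv k) := by
  have hk' : Continuous (deriv k) := hk.continuous_deriv le_rfl
  obtain ⟨C, hC⟩ := hk.continuous.bounded_above_of_compact_support hkc
  obtain ⟨C', hC'⟩ := hk'.bounded_above_of_compact_support hkc.deriv
  obtain ⟨R, hR⟩ := hkc.isCompact.isBounded.exists_norm_le
  have hkR : ∀ x, R < |x| → k x = 0 := fun x hx => by
    by_contra h
    exact (hR x (subset_tsupport k h)).not_gt hx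
  have hkR' : ∀ x, R < |x| → deriv k x = 0 := fun x hx => by
    by_contra h
    exact (hR x (support_deriv_subset h)).not_gt hx
  set p : (ℝ → ℝ) → ℕ → ℝ → ℝ := fun k n =>
    convolution ((originBump n).normed volume) k (ContinuousLinearMap.lsmul ℝ ℝ) volume
  have hsm : ∀ n, ContDiff ℝ (⊤ : ℕ∞) (p k n) := fun n =>
    (originBump n).hasCompactSupport_normed.contDiff_convolution_left _
      (originBump n).contDiff_normed hk.continuous.locallyIntegrable
  have hder : ∀ n, deriv (p k n) = p (deriv k) n := fun n => funext fun x =>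
    (hkc.hasDerivAt_convolution_right _
      (originBump n).continuous_normed.locallyIntegrable hk x).deriv
  set M := max (3 * C) (3 * C')
  have hMi : ∀ x, (Icc (-(R + 1)) (R + 1)).indicator (fun _ => 3 * C) x ≤
      (Icc (-(R + 1)) (R + 1)).indicator (fun _ => M) x := fun x =>
    indicator_le_indicator (le_max_left _ _)
  have hMi' : ∀ x, (Icc (-(R + 1)) (R + 1)).indicator (fun _ => 3 * C') x ≤
      (Icc (-(R + 1)) (R + 1)).indicator (fun _ => M) x := fun x =>
    indicator_le_indicator (le_max_right _ _)
  refine IsAxialByParts.of_tendsto hv (p := p k) (q := p (deriv k))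
    (G := (Icc (-(R + 1)) (R + 1)).indicator fun _ => M)
    (memLp_indicator_const 2 measurableSet_Icc _ (Or.inr (by simp)))
    (fun n => (hsm n).continuous) (fun n => ?_)
    (fun n x => (abs_convolution_originBump_le hk.continuous hC hkR n x).trans (hMi x))
    (fun n x => (abs_convolution_originBump_le hk' hC' hkR' n x).trans (hMi' x))
    (ContDiffBump.convolution_tendsto_right_of_continuous tendsto_originBump_rOut hk.continuous)
    (ContDiffBump.convolution_tendsto_right_of_continuous tendsto_originBump_rOut hk')
    (fun n => ?_)
  · rw [← hder]
    exact (hsm n).continuous_deriv (by simp)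
  · rw [← hder]
    exact isAxialByParts_of_contDiff hv (hsm n)
      ((originBump n).hasCompactSupport_normed.convolution _ hkc)

/-- A fixed cutoff function on the line. -/
noncomputable def cutoff : ContDiffBump (0 : ℝ) where
  rIn := 1
  rOut := 2
  rIn_pos := one_pos
  rIn_lt_rOut := one_lt_two

/-- By cutting off at infinity, axial integration by parts extends to functions in `H¹(ℝ)` with
continuous derivative. -/
theorem isAxialByParts_of_memLp {v : Space d → ℝ} {Dv : Space d → Space d} (hv : IsH1 v Dv)
    {g g' : ℝ → ℝ} (hg : ∀ x, HasDerivAt g (g' x) x) (hgc : Continuous g')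
    (hg2 : MemLp g 2) (hg2' : MemLp g' 2) : IsAxialByParts v Dv g g' := by
  have hgcont : Continuous g := continuous_iff_continuousAt.2 fun x => (hg x).continuousAt
  have hη : ContDiff ℝ (⊤ : ℕ∞) cutoff := cutoff.contDiff
  have hηd : ∀ x, HasDerivAt cutoff (deriv cutoff x) x := fun x =>
    (hη.differentiable (by simp) x).hasDerivAt
  have hη' : Continuous (deriv cutoff) := hη.continuous_deriv (by simp)
  obtain ⟨C, hC⟩ := hη'.bounded_above_of_compact_support cutoff.hasCompactSupport.deriv
  have hη1 : ∀ x, |cutoff x| ≤ 1 := fun x => by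
    rw [abs_of_nonneg cutoff.nonneg]; exact cutoff.le_one
  have hC0 : 0 ≤ C := (norm_nonneg _).trans (hC 0)
  set r : ℕ → ℝ := fun n => 1 / ((n : ℝ) + 1) with hr
  have hr0 : ∀ n, 0 < r n := fun n => by positivity
  have hr1 : ∀ n, r n ≤ 1 := fun n => by
    rw [hr, div_le_one (by positivity)]
    linarith [n.cast_nonneg (α := ℝ)]
  have hrt : Tendsto r atTop (𝓝 0) := tendsto_one_div_add_atTop_nhds_zero_nat
  set p : ℕ → ℝ → ℝ := fun n x => cutoff (r n * x) * g x with hp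
  set q : ℕ → ℝ → ℝ := fun n x =>
    deriv cutoff (r n * x) * r n * g x + cutoff (r n * x) * g' x with hq
  have hpd : ∀ n x, HasDerivAt (p n) (q n x) x := fun n x => by
    have h1 : HasDerivAt (fun x => r n * x) (r n) x := by
      simpa using (hasDerivAt_id x).const_mul (r n)
    exact ((hηd _).comp x h1).mul (hg x)
  have hqc : ∀ n, Continuous (q n) := fun n => by
    have h1 : Continuous fun x => r n * x := by fun_prop
    exact (((hη'.comp h1).mul continuous_const).mul hgcont).add
      ((cutoff.continuous.comp h1).mul hgc)
  have hpc : ∀ n, ContDiff ℝ 1 (p n) := fun n =>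
    contDiff_one_iff_deriv.2 ⟨fun x => (hpd n x).differentiableAt, by
      rw [show deriv (p n) = q n from funext fun x => (hpd n x).deriv]
      exact hqc n⟩
  have hps : ∀ n, HasCompactSupport (p n) := fun n =>
    (cutoff.hasCompactSupport.comp_homeomorph
      (Homeomorph.mulLeft₀ (r n) (hr0 n).ne')).mul_right
  refine IsAxialByParts.of_tendsto hv (p := p) (q := q)
    (G := fun x => (1 + C) * |g x| + |g' x|)
    ((hg2.norm.const_mul _).add hg2'.norm) (fun n => (hpc n).continuous) hqc
    (fun n x => ?_) (fun n x => ?_) (fun x => ?_) (fun x => ?_) (fun n => ?_)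
  · rw [hp, abs_mul]
    nlinarith [hη1 (r n * x), abs_nonneg (g x), abs_nonneg (g' x)]
  · have h1 : |deriv cutoff (r n * x) * r n * g x| ≤ C * |g x| := by
      rw [abs_mul, abs_mul, abs_of_pos (hr0 n)]
      refine mul_le_mul_of_nonneg_right ?_ (abs_nonneg _)
      calc _ ≤ C * 1 := mul_le_mul (hC _) (hr1 n) (hr0 n).le hC0
        _ = C := mul_one C
    have h2 : |cutoff (r n * x) * g' x| ≤ |g' x| := by
      rw [abs_mul]
      exact mul_le_of_le_one_left (abs_nonneg _) (hη1 _)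
    calc |q n x| ≤ _ := abs_add_le _ _
      _ ≤ (1 + C) * |g x| + |g' x| := by linarith [abs_nonneg (g x)]
  · have h1 : Tendsto (fun n => cutoff (r n * x)) atTop (𝓝 (cutoff (0 * x))) :=
      (cutoff.continuous.tendsto _).comp (hrt.mul_const x)
    rw [zero_mul, cutoff.one_of_mem_closedBall (by simp [cutoff])] at h1
    simpa using h1.mul_const (g x)
  · have h1 : Tendsto (fun n => cutoff (r n * x)) atTop (𝓝 (cutoff (0 * x))) :=
      (cutoff.continuous.tendsto _).comp (hrt.mul_const x)
    rw [zero_mul, cutoff.one_of_mem_closedBall (by simp [cutoff])] at h1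
    have h2 : Tendsto (fun n => deriv cutoff (r n * x)) atTop (𝓝 (deriv cutoff (0 * x))) :=
      (hη'.tendsto _).comp (hrt.mul_const x)
    simpa using ((h2.mul hrt).mul_const (g x)).add (h1.mul_const (g' x))
  · rw [show q n = deriv (p n) from funext fun x => (hpd n x).deriv.symm]
    exact isAxialByParts_of_contDiff_one hv (hpc n) (hps n)

/-! ### Upper bound of the energy in tubular coordinates -/

/-- The profile satisfies the Euler–Lagrange equation `m'' = F'(m)` weakly on the cylinder: the
first variation of the energy at a translated profile vanishes on `H¹`. -/
theorem integral_first_variation (hF : IsDoubleWell F) {v : Space d → ℝ}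
    {Dv : Space d → Space d} (hv : IsH1 v Dv) (ξ : ℝ) :
    ∫ z, (deriv (profile F) (z 0 - ξ) * Dv z 0 + deriv F (profile F (z 0 - ξ)) * v z)
      ∂(domainMeasure d) = 0 := by
  have hm := hF.isProfile_profile
  have hsh := measurePreserving_sub_right (volume : Measure ℝ) ξ
  have hg : MemLp (fun x => deriv (profile F) (x - ξ)) 2 :=
    (hm.memLp_deriv hF).comp_measurePreserving hsh
  have hg' : MemLp (fun x => deriv F (profile F (x - ξ))) 2 :=
    (hm.memLp_deriv_comp hF).comp_measurePreserving hsh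
  have h := isAxialByParts_of_memLp hv
    (fun x => (hm.hasDerivAt_deriv hF (x - ξ)).comp_sub_const x ξ)
    (hF.continuous_deriv.comp (hm.continuous.comp (continuous_id.sub continuous_const))) hg hg'
  have i1 : Integrable (fun z : Space d => deriv (profile F) (z 0 - ξ) * Dv z 0)
      (domainMeasure d) := (memLp_comp_axial hg).integrable_mul (memLp_apply hv.memLp_grad 0)
  have i2 : Integrable (fun z : Space d => deriv F (profile F (z 0 - ξ)) * v z)
      (domainMeasure d) := (memLp_comp_axial hg').integrable_mul hv.memLp
  rw [IsAxialByParts] at h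
  rw [integral_add i1 i2]
  simp only [mul_comm (deriv F _)] at h ⊢
  linarith

/-- Taylor's formula for the potential near the interval `[-1, 1]`. -/
theorem IsDoubleWell.exists_add_le (hF : IsDoubleWell F) : ∃ K : ℝ, 0 ≤ K ∧
    ∀ u w : ℝ, |u| ≤ 1 → |w| ≤ 1 → F (u + w) ≤ F u + deriv F u * w + K * w ^ 2 := by
  obtain ⟨K, hK⟩ := isCompact_Icc.exists_bound_of_continuousOn
    (hF.continuous_deriv_deriv.continuousOn (s := Icc (-2 : ℝ) 2))
  refine ⟨K, (norm_nonneg _).trans (hK 0 (by norm_num)), fun u w hu hw => ?_⟩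
  have hseg : segment ℝ u (u + w) ⊆ Icc (-2 : ℝ) 2 := by
    refine (convex_Icc _ _).segment_subset ?_ ?_ <;>
      constructor <;> linarith [abs_le.1 hu, abs_le.1 hw, (abs_le.1 hu).1, (abs_le.1 hu).2,
        (abs_le.1 hw).1, (abs_le.1 hw).2]
  have h0 : u ∈ segment ℝ u (u + w) := left_mem_segment ..
  have h1 : u + w ∈ segment ℝ u (u + w) := right_mem_segment ..
  have hdist : ∀ y ∈ segment ℝ u (u + w), |y - u| ≤ |w| := by
    rintro y ⟨a, b, ha, hb, hab, rfl⟩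
    have : a • u + b • (u + w) - u = b * w := by
      simp only [smul_eq_mul]
      linear_combination u * hab
    rw [this, abs_mul, abs_of_nonneg hb]
    exact mul_le_of_le_one_left (abs_nonneg _) (by linarith)
  have hd : ∀ y ∈ segment ℝ u (u + w), ‖deriv F y - deriv F u‖ ≤ K * |w| := by
    intro y hy
    have := (convex_segment u (u + w)).norm_image_sub_le_of_norm_hasDerivWithin_le
      (fun t _ => (hF.hasDerivAt_deriv t).hasDerivWithinAt)
      (fun t ht => hK t (hseg ht)) h0 hy
    refine this.trans (mul_le_mul_of_nonneg_left (hdist y hy) ?_)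
    exact (norm_nonneg _).trans (hK 0 (by norm_num))
  have hlin : ∀ t, HasDerivAt (fun y => F y - deriv F u * y) (deriv F t - deriv F u) t :=
    fun t => (hF.hasDerivAt t).fun_sub
      (by simpa using (hasDerivAt_id t).const_mul (deriv F u))
  have h := (convex_segment u (u + w)).norm_image_sub_le_of_norm_hasDerivWithin_le
    (fun t _ => (hlin t).hasDerivWithinAt) hd h0 h1
  rw [Real.norm_eq_abs, Real.norm_eq_abs, add_sub_cancel_left, mul_assoc, abs_mul_abs_self] at h
  have := (abs_le.1 h).2
  linarith

theorem gradient_wave (hm : IsProfile F (profile F)) (ξ : ℝ) (z : Space d) :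
    gradient (wave F d ξ) z =
      EuclideanSpace.single 0 (deriv (profile F) (z 0 - ξ)) := by
  refine HasGradientAt.gradient ?_
  rw [hasGradientAt_iff_hasFDerivAt]
  have h1 : HasFDerivAt (fun z : Space d => z 0 - ξ)
      (EuclideanSpace.proj (𝕜 := ℝ) (0 : Fin (d + 1)) : Space d →L[ℝ] ℝ) z :=
    (EuclideanSpace.proj (𝕜 := ℝ) (0 : Fin (d + 1))).hasFDerivAt.sub_const ξ
  have h2 := (hm.hasDerivAt (z 0 - ξ)).differentiableAt.hasDerivAt.comp_hasFDerivAt z h1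
  refine h2.congr_fderiv ?_
  ext w
  simp [EuclideanSpace.inner_single_left]

/-- A perturbation bounded by one of a translated profile has excess energy at most quadratic in
its `H¹` norm. -/
theorem exists_freeEnergy_le (hF : IsDoubleWell F) (d : ℕ) : ∃ c : ℝ, 0 < c ∧
    ∀ (h : Space d → ℝ) (ξ : ℝ) (v : Space d → ℝ) (Dv : Space d → Space d),
      h =ᵐ[domainMeasure d] (fun z => wave F d ξ z + v z) → IsH1 v Dv →
      eLpNorm v ∞ (domainMeasure d) ≤ 1 →
        freeEnergy F h (fun z => gradient (wave F d ξ) z + Dv z) ≤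
          ((c * h1NormSq v Dv : ℝ) : EReal) := by
  have hm := hF.isProfile_profile
  obtain ⟨K, hK0, hK⟩ := hF.exists_add_le
  refine ⟨K + 1, by positivity, fun h ξ v Dv hh hv hv1 => ?_⟩
  have hsh := measurePreserving_sub_right (volume : Measure ℝ) ξ
  have ha : MemLp (fun z : Space d => deriv (profile F) (z 0 - ξ)) 2 (domainMeasure d) :=
    memLp_comp_axial ((hm.memLp_deriv hF).comp_measurePreserving hsh)
  have hb : MemLp (fun z : Space d => deriv F (profile F (z 0 - ξ))) 2 (domainMeasure d) :=
    memLp_comp_axial ((hm.memLp_deriv_comp hF).comp_measurePreserving hsh)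
  have hsq : ∫ z : Space d, deriv (profile F) (z 0 - ξ) ^ 2 ∂(domainMeasure d) =
      surfaceTension F := by
    have hcs : Continuous fun x => deriv (profile F) (x - ξ) ^ 2 :=
      ((hm.continuous_deriv hF).comp (continuous_id.sub continuous_const)).pow 2
    rw [← hm.integral_deriv_sq hF,
      ← integral_sub_right_eq_self (fun x => deriv (profile F) x ^ 2) ξ,
      ← (measurePreserving_axial d).map_eq, integral_map
        (measurePreserving_axial d).measurable.aemeasurable hcs.aestronglyMeasurable]
  have iA := ha.integrable_sq
  have iB : Integrable (fun z : Space d => deriv (profile F) (z 0 - ξ) * Dv z 0 +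
      deriv F (profile F (z 0 - ξ)) * v z) (domainMeasure d) :=
    (ha.integrable_mul (memLp_apply hv.memLp_grad 0)).add (hb.integrable_mul hv.memLp)
  have iV := hv.memLp.integrable_sq
  have iD : Integrable (fun z => ‖Dv z‖ ^ 2) (domainMeasure d) :=
    hv.memLp_grad.norm.integrable_sq
  have iN : Integrable (fun z => v z ^ 2 + ‖Dv z‖ ^ 2) (domainMeasure d) := iV.add iD
  set Q : Space d → ℝ := fun z => deriv (profile F) (z 0 - ξ) ^ 2 +
    (deriv (profile F) (z 0 - ξ) * Dv z 0 + deriv F (profile F (z 0 - ξ)) * v z) +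
    (K + 1) * (v z ^ 2 + ‖Dv z‖ ^ 2)
  have iAB := iA.add iB
  simp only [Pi.add_def] at iAB
  have hQi : Integrable Q (domainMeasure d) := iAB.add (iN.const_mul _)
  have hQ : ∫ z, Q z ∂(domainMeasure d) = surfaceTension F + (K + 1) * h1NormSq v Dv := by
    rw [integral_add iAB (iN.const_mul _), integral_add iA iB, hsq,
      integral_first_variation hF hv ξ, integral_const_mul, add_zero, h1NormSq]
  have hv1' : ∀ᵐ z ∂(domainMeasure d), |v z| ≤ 1 := by
    rw [eLpNorm_exponent_top] at hv1
    filter_upwards [ae_le_eLpNormEssSup (f := v) (μ := domainMeasure d)] with z hz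
    have := hz.trans hv1
    rwa [← ofReal_norm, ENNReal.ofReal_le_one, Real.norm_eq_abs] at this
  have hle : ∀ᵐ z ∂(domainMeasure d),
      ‖gradient (wave F d ξ) z + Dv z‖ ^ 2 / 2 + F (h z) ≤ Q z := by
    filter_upwards [hh, hv1'] with z hz hvz
    have hT := hK (profile F (z 0 - ξ)) (v z) (hm.abs_le_one _) hvz
    rw [hz, wave, gradient_wave hm, norm_add_sq_real, EuclideanSpace.inner_single_left,
      PiLp.norm_single, Real.norm_eq_abs, sq_abs]
    -- half of `m'² = 2 F(m)` comes from the gradient and half from the potential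
    have hFm := hm.deriv_sq hF (z 0 - ξ)
    simp only [Q, conj_trivial]
    nlinarith [sq_nonneg ‖Dv z‖, sq_nonneg (v z), mul_nonneg hK0 (sq_nonneg ‖Dv z‖)]
  have hQ0 : 0 ≤ᵐ[domainMeasure d] Q := hle.mono fun z hz =>
    (add_nonneg (by positivity) (hF.nonneg _)).trans hz
  have hN0 : 0 ≤ h1NormSq v Dv := integral_nonneg fun z => by positivity
  rw [freeEnergy_le_iff (add_nonneg (surfaceTension_nonneg F) (by positivity)), ← hQ,
    ofReal_integral_eq_lintegral_ofReal hQi hQ0]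
  exact lintegral_mono_ae (hle.mono fun z hz => ENNReal.ofReal_le_ofReal hz)

end AllenCahn

theorem proposition2p1 (d : ℕ) (F : ℝ → ℝ) (hF : AllenCahn.IsDoubleWell F) :
    (∃ c₃ δ₃ : ℝ, 0 < c₃ ∧ 0 < δ₃ ∧
      ∀ (h : AllenCahn.Space d → ℝ) (ξ : ℝ) (v : AllenCahn.Space d → ℝ)
        (Dv : AllenCahn.Space d → AllenCahn.Space d),
        AllenCahn.IsTubularCoord F h ξ v →
        AllenCahn.IsH1 v Dv →
        eLpNorm v 2 (AllenCahn.domainMeasure d) ≤ ENNReal.ofReal δ₃ →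
        eLpNorm v ∞ (AllenCahn.domainMeasure d) ≤ 1 →
        AllenCahn.freeEnergy F h (fun z => gradient (AllenCahn.wave F d ξ) z + Dv z) ≤
          ((c₃ * AllenCahn.h1NormSq v Dv : ℝ) : EReal)) ∧
    (∃ c₀ δ₀ : ℝ, 0 < c₀ ∧ 0 < δ₀ ∧
      ∀ δ : ℝ, 0 ≤ δ → δ ≤ δ₀ →
        ∀ h : AllenCahn.Space d → ℝ,
          AllenCahn.PiecewiseDifferentiable h →
          AllenCahn.HasBoundaryValues h →
          ENNReal.ofReal δ < AllenCahn.distL2 F h →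
          ((c₀ * δ ^ 2 : ℝ) : EReal) < AllenCahn.freeEnergy F h (gradient h)) := by
  constructor
  · obtain ⟨c, hc, H⟩ := AllenCahn.exists_freeEnergy_le hF d
    exact ⟨c, 1, hc, one_pos, fun h ξ v Dv hh hv _ hv1 => H h ξ v Dv hh.eq_add hv hv1⟩
  · exact AllenCahn.exists_lt_freeEnergy hF d
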